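/- Let $a>-1$ be real. For $t>0$ let $p_n(x;t)$, $n\ge 0$, be the orthonormal polynomials (with positive leading coefficient) for the deformed Laguerre weight $w(x;t)=x^2(x+t)^a e^{-x}$ on $(0,\infty)$, i.e. $\deg p_n(\cdot;t)=n$ and $\int_0^\infty w(x;t)\,p_m(x;t)\,p_n(x;t)\,dx=\delta_{m,n}$; put $p_{-1}=0$. Define $$Q_n(x;t)=\frac{p_n(x;t)}{p_n(0;t)},\qquad R_n(x;t)=Q_n(x;t)-Q_{n-1}(x;t)$$ (all zeros of $p_n(\cdot;t)$ lie in $(0,\infty)$, so $p_n(0;t)\ne 0$ for $n\ge 0$; $Q_{-1}=0$). Then there are functions $q(z;s)$ and $p(z;s)$ of $z\in\mathbb{C}$ and $s>0$, entire in $z$ for each $s>0$, such that for every $s>0$ and every $z\in\mathbb{C}$ $$\lim_{n\to\infty}Q_n\!\left(-\frac{z}{4n};\frac{s}{4n}\right)=q(z;s),\qquad \lim_{n\to\infty}n\,R_n\!\left(-\frac{z}{4n};\frac{s}{4n}\right)=p(z;s).$$ -/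

import Mathlib

open Polynomial

noncomputable section

namespace DeformedLaguerre

/-- The deformed Laguerre weight `w(x;t) = x² (x+t)^a e^{-x}`, to be used for `x > 0`. -/
def weight (a t x : ℝ) : ℝ := x ^ 2 * (x + t) ^ a * Real.exp (-x)

/-- The pairing `∫₀^∞ w(x;t) f(x) g(x) dx` of real polynomials. -/
def pairing (a t : ℝ) (f g : ℝ[X]) : ℝ :=
  ∫ x in Set.Ioi (0 : ℝ), weight a t x * (f.eval x * g.eval x)

/-- The monic orthogonal polynomials `π_n(·;t)`, built by the Gram-Schmidt procedure
from `1, X, X², …`. -/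
def monicPoly (a t : ℝ) (n : ℕ) : ℝ[X] :=
  X ^ n - ∑ k : Fin n,
    C (pairing a t (X ^ n) (monicPoly a t k) /
        pairing a t (monicPoly a t k) (monicPoly a t k)) * monicPoly a t k
termination_by n
decreasing_by all_goals exact k.isLt

/-- The orthonormal polynomials `p_n(·;t)`, with positive leading coefficient. -/
def orthoPoly (a t : ℝ) (n : ℕ) : ℝ[X] :=
  C (Real.sqrt (pairing a t (monicPoly a t n) (monicPoly a t n)))⁻¹ * monicPoly a t n

/-- The ratio `Q_n(x;t) = p_n(x;t) / p_n(0;t)`, at a complex argument `x`. -/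
def Q (a : ℝ) (n : ℕ) (x : ℂ) (t : ℝ) : ℂ :=
  aeval x (orthoPoly a t n) / aeval (0 : ℂ) (orthoPoly a t n)

/-- The difference `R_n = Q_n - Q_{n-1}`; here `Q_{-1} = 0`, as `p_{-1} = 0`. -/
def R (a : ℝ) : ℕ → ℂ → ℝ → ℂ
  | 0, x, t => Q a 0 x t
  | n + 1, x, t => Q a (n + 1) x t - Q a n x t

/-! Helper facts: for `t > 0` the polynomials above are the orthonormal polynomials of the
weight `w(·;t)` on the half line. -/

theorem weight_pos {a t x : ℝ} (ht : 0 < t) (hx : 0 < x) : 0 < weight a t x := by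
  have := Real.rpow_pos_of_pos (add_pos hx ht) a
  unfold weight
  positivity

theorem integrableOn_weight_mul {t : ℝ} (a : ℝ) (ht : 0 < t) (f : ℝ[X]) :
    MeasureTheory.IntegrableOn (fun x => weight a t x * f.eval x) (Set.Ioi 0) := by
  have hw : ContinuousOn (fun x => weight a t x * f.eval x) (Set.Ici 0) := by
    unfold weight
    refine ContinuousOn.mul (ContinuousOn.mul (ContinuousOn.mul (by fun_prop) ?_)
      (by fun_prop)) (by fun_prop)
    refine ContinuousOn.rpow_const (by fun_prop) ?_
    intro x hx
    left
    have : 0 ≤ x := hx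
    positivity
  refine integrable_of_isBigO_exp_neg (b := 1 / 2) (by norm_num) hw ?_
  have h1 : (fun x : ℝ => (x + t) ^ a) =O[Filter.atTop] fun x => Real.exp (1 / 4 * x) := by
    have h := ((isLittleO_rpow_exp_pos_mul_atTop a (b := 1 / 4) (by norm_num)).isBigO).comp_tendsto
      (Filter.tendsto_atTop_add_const_right Filter.atTop t Filter.tendsto_id)
    refine h.trans ?_
    refine Asymptotics.IsBigO.of_bound (Real.exp (1 / 4 * t)) (Filter.Eventually.of_forall ?_)
    intro x
    simp only [Function.comp, id, Real.norm_eq_abs, Real.abs_exp, ← Real.exp_add]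
    apply le_of_eq
    congr 1
    ring
  have h2 : (fun x : ℝ => (X ^ 2 * f).eval x) =O[Filter.atTop] fun x => Real.exp (1 / 4 * x) := by
    have h := Polynomial.isBigO_atTop_of_degree_le (X ^ 2 * f) (X ^ (X ^ 2 * f).natDegree)
      (by rw [degree_X_pow]; exact degree_le_natDegree)
    refine h.trans ?_
    simpa using (isLittleO_pow_exp_pos_mul_atTop (X ^ 2 * f).natDegree (b := 1 / 4)
      (by norm_num)).isBigO
  have h3 := ((h1.mul h2).mul (Asymptotics.isBigO_refl (fun x : ℝ => Real.exp (-x)) Filter.atTop))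
  refine (h3.congr (fun x => ?_) (fun x => ?_))
  · simp only [weight, eval_mul, eval_pow, eval_X]
    ring
  · rw [← Real.exp_add, ← Real.exp_add]
    congr 1
    ring

theorem integrableOn_pairing {t : ℝ} (a : ℝ) (ht : 0 < t) (f g : ℝ[X]) :
    MeasureTheory.IntegrableOn (fun x => weight a t x * (f.eval x * g.eval x)) (Set.Ioi 0) := by
  simpa using integrableOn_weight_mul a ht (f * g)

theorem pairing_comm (a t : ℝ) (f g : ℝ[X]) : pairing a t f g = pairing a t g f := by
  unfold pairing
  simp only [mul_comm (f.eval _)]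

theorem pairing_C_mul (a t c : ℝ) (f g : ℝ[X]) :
    pairing a t (C c * f) g = c * pairing a t f g := by
  unfold pairing
  rw [← MeasureTheory.integral_const_mul]
  congr 1
  ext x
  simp only [eval_mul, eval_C]
  ring

theorem pairing_sub {t : ℝ} (a : ℝ) (ht : 0 < t) (f g h : ℝ[X]) :
    pairing a t (f - g) h = pairing a t f h - pairing a t g h := by
  unfold pairing
  rw [← MeasureTheory.integral_sub (integrableOn_pairing a ht f h) (integrableOn_pairing a ht g h)]
  congr 1
  ext x
  simp only [eval_sub]
  ring

theorem pairing_sum {t : ℝ} (a : ℝ) (ht : 0 < t) {ι : Type*} (s : Finset ι) (f : ι → ℝ[X])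
    (h : ℝ[X]) : pairing a t (∑ i ∈ s, f i) h = ∑ i ∈ s, pairing a t (f i) h := by
  unfold pairing
  rw [← MeasureTheory.integral_finsetSum s (fun i _ => integrableOn_pairing a ht (f i) h)]
  congr 1
  ext x
  rw [eval_finsetSum, Finset.sum_mul, Finset.mul_sum]

theorem pairing_self_pos {t : ℝ} (a : ℝ) (ht : 0 < t) {f : ℝ[X]} (hf : f ≠ 0) :
    0 < pairing a t f f := by
  unfold pairing
  rw [MeasureTheory.setIntegral_pos_iff_support_of_nonneg_ae ?_ (integrableOn_pairing a ht f f)]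
  · have hsub : Set.Ioi (0 : ℝ) \ (f.roots.toFinset : Set ℝ) ⊆
        (Function.support fun x => weight a t x * (f.eval x * f.eval x)) ∩ Set.Ioi 0 := by
      rintro x ⟨hx, hr⟩
      refine ⟨?_, hx⟩
      have h0 : f.eval x ≠ 0 := by
        intro h
        apply hr
        simp [hf, h]
      exact mul_ne_zero (weight_pos ht hx).ne' (mul_ne_zero h0 h0)
    refine lt_of_lt_of_le ?_ (MeasureTheory.measure_mono hsub)
    rw [MeasureTheory.measure_sdiff_null (f.roots.toFinset.finite_toSet.measure_zero _)]
    simp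
  · filter_upwards [MeasureTheory.ae_restrict_mem measurableSet_Ioi] with x hx
    exact mul_nonneg (weight_pos ht hx).le (mul_self_nonneg _)

theorem monicPoly_natDegree_monic (a t : ℝ) (n : ℕ) :
    (monicPoly a t n).Monic ∧ (monicPoly a t n).natDegree = n := by
  induction n using Nat.strong_induction_on with
  | _ n ih =>
    have hd : (∑ k : Fin n,
        C (pairing a t (X ^ n) (monicPoly a t k) /
          pairing a t (monicPoly a t k) (monicPoly a t k)) * monicPoly a t k).degree < n := by
      refine lt_of_le_of_lt (degree_sum_le _ _) ?_
      refine (Finset.sup_lt_iff (WithBot.bot_lt_coe n)).2 ?_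
      intro k _
      rw [← smul_eq_C_mul]
      refine lt_of_le_of_lt (degree_smul_le _ _) ?_
      rw [degree_eq_natDegree (ih k k.isLt).1.ne_zero, (ih k k.isLt).2]
      exact WithBot.coe_lt_coe.2 (Nat.cast_lt.2 k.isLt)
    rw [monicPoly]
    refine ⟨monic_X_pow_sub hd, ?_⟩
    refine natDegree_eq_of_degree_eq_some ?_
    rw [degree_sub_eq_left_of_degree_lt (by rwa [degree_X_pow]), degree_X_pow]

theorem pairing_monicPoly_of_lt {t : ℝ} (a : ℝ) (ht : 0 < t) (n : ℕ) :
    ∀ m < n, pairing a t (monicPoly a t n) (monicPoly a t m) = 0 := by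
  induction n using Nat.strong_induction_on with
  | _ n ih =>
    intro m hm
    rw [monicPoly, pairing_sub a ht, pairing_sum a ht, Finset.sum_eq_single ⟨m, hm⟩]
    · rw [pairing_C_mul, div_mul_cancel₀, sub_self]
      exact (pairing_self_pos a ht (monicPoly_natDegree_monic a t m).1.ne_zero).ne'
    · intro k _ hk
      rw [pairing_C_mul]
      have hkm : (k : ℕ) ≠ m := fun h => hk (Fin.ext h)
      rcases lt_or_gt_of_ne hkm with h | h
      · rw [pairing_comm a t (monicPoly a t k) (monicPoly a t m), ih m hm k h, mul_zero]
      · rw [ih k k.isLt m h, mul_zero]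
    · simp

/-- `p_n` has degree `n` and positive leading coefficient. -/
theorem orthoPoly_degree {t : ℝ} (a : ℝ) (ht : 0 < t) (n : ℕ) :
    (orthoPoly a t n).natDegree = n ∧ 0 < (orthoPoly a t n).leadingCoeff := by
  obtain ⟨h1, h2⟩ := monicPoly_natDegree_monic a t n
  have h3 := Real.sqrt_pos.2 (pairing_self_pos a ht h1.ne_zero)
  unfold orthoPoly
  refine ⟨?_, ?_⟩
  · rw [natDegree_C_mul (inv_pos.2 h3).ne', h2]
  · rw [leadingCoeff_mul, leadingCoeff_C, h1.leadingCoeff, mul_one]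
    exact inv_pos.2 h3

/-- The `p_n` are orthonormal for the weight `w(·;t)` on `(0,∞)`. -/
theorem pairing_orthoPoly {t : ℝ} (a : ℝ) (ht : 0 < t) (m n : ℕ) :
    pairing a t (orthoPoly a t m) (orthoPoly a t n) = if m = n then 1 else 0 := by
  unfold orthoPoly
  rw [pairing_C_mul, pairing_comm a t (monicPoly a t m) (C _ * _), pairing_C_mul]
  split_ifs with h
  · subst h
    have h1 := pairing_self_pos a ht (monicPoly_natDegree_monic a t m).1.ne_zero
    have h2 := Real.mul_self_sqrt h1.le
    have h3 := (Real.sqrt_pos.2 h1).ne'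
    field_simp
    rw [sq, h2]
  · rcases lt_or_gt_of_ne h with h | h
    · rw [pairing_monicPoly_of_lt a ht n m h]
      simp
    · rw [pairing_comm a t (monicPoly a t n) (monicPoly a t m), pairing_monicPoly_of_lt a ht m n h]
      simp

end DeformedLaguerre

end

/-! Put N = 4n, x = y/N, t = s/N. Up to a constant the weight becomes y^2 (y+s)^a e^{-y/N}, and the
argument -z/N becomes the fixed point y = -z. For m = 0, 1 let g_m be the polynomial of degree at
most n representing p ↦ p(0) for the weight y^m (y+s)^a e^{-y/N}. Since g_1 annihilates every y r
with deg r < n, it is the orthogonal polynomial of degree n for m = 2, so Q_n = g_1(-z)/g_1(0)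
(`IsReprAtZero.Q_eq`). It remains to control g_0 and g_1.

Convergence of g_m (`exists_tendsto_coeff`) comes from comparison with the Laguerre weight y^{m+a}
e^{-y/N}. There the polynomials E_j representing the coefficient functionals are explicit, have
convergent coefficients, and have norms at most b_j, where Σ b_j r^j < ∞ for all r. By
Cauchy–Schwarz a polynomial of norm at most A has coefficients bounded by A b_j. The norms of g_m
are bounded (`exists_wpair_bound`), so the coefficient sequences stay in a compact product of
intervals. Every limit point c solves c_j + ∫ ρ y^{m+a} c(y) E_j(y) dy = E_j(0), where ρ =
((y+s)/y)^a - 1 = O(1/y) at infinity and E_j now denotes the limit. The solution is unique because 1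
+ ρ > 0 (`eq_zero_of_homogeneous`), so the whole sequence converges.

For R_n, g_0 is the orthogonal polynomial of degree n for m = 1. Removing from g_1 its g_0 component
leaves the kernel of degree n - 1, hence Q_{n-1}. This gives R_n = c/(1-c) (g_0/g_0(0) - g_1/g_1(0))
with c = g_0(0)^2/(g_1(0) T) and T = ∫ y (y+s)^a e^{-y/N} g_0^2 (`R_eq`). Integration by parts
yields T = 4n Δ_n with Δ_n tending to a positive limit (`IsReprAtZero.wpair_vw_one_self`), so n c
converges. -/

namespace DeformedLaguerre

open MeasureTheory Set Filter Topology

/-! ### Pairings of polynomials on the half line, and the two families of weights. -/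

noncomputable section

/-- The pairing of real polynomials on the half line with respect to a density `ω`. -/
def wpair (ω : ℝ → ℝ) (f g : ℝ[X]) : ℝ :=
  ∫ y in Ioi (0 : ℝ), ω y * (f.eval y * g.eval y)

/-- A positive density on the half line with finite moments of all orders. -/
structure IsWeight (ω : ℝ → ℝ) : Prop where
  pos : ∀ y, 0 < y → 0 < ω y
  int : ∀ f : ℝ[X], IntegrableOn (fun y => ω y * f.eval y) (Ioi 0)

section wpair

variable {ω : ℝ → ℝ}

theorem IsWeight.int_mul (h : IsWeight ω) (f g : ℝ[X]) :
    IntegrableOn (fun y => ω y * (f.eval y * g.eval y)) (Ioi 0) := by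
  simpa using h.int (f * g)

theorem wpair_comm (ω : ℝ → ℝ) (f g : ℝ[X]) : wpair ω f g = wpair ω g f := by
  unfold wpair
  simp only [mul_comm (f.eval _)]

theorem IsWeight.wpair_add_left (h : IsWeight ω) (f g p : ℝ[X]) :
    wpair ω (f + g) p = wpair ω f p + wpair ω g p := by
  unfold wpair
  rw [← integral_add (h.int_mul f p) (h.int_mul g p)]
  congr 1
  ext y
  simp only [eval_add]
  ring

theorem wpair_smul_left (ω : ℝ → ℝ) (c : ℝ) (f p : ℝ[X]) :
    wpair ω (c • f) p = c * wpair ω f p := by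
  unfold wpair
  rw [← integral_const_mul]
  congr 1
  ext y
  simp only [eval_smul, smul_eq_mul]
  ring

/-- The pairing as a bilinear form. -/
def IsWeight.form (h : IsWeight ω) : ℝ[X] →ₗ[ℝ] ℝ[X] →ₗ[ℝ] ℝ :=
  LinearMap.mk₂ ℝ (wpair ω) h.wpair_add_left (wpair_smul_left ω)
    (fun f g p => by rw [wpair_comm, h.wpair_add_left, wpair_comm ω g, wpair_comm ω p])
    (fun c f p => by rw [wpair_comm, wpair_smul_left, wpair_comm, smul_eq_mul])

@[simp] theorem IsWeight.form_apply (h : IsWeight ω) (f g : ℝ[X]) : h.form f g = wpair ω f g := rfl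

theorem IsWeight.wpair_self_nonneg (h : IsWeight ω) (f : ℝ[X]) : 0 ≤ wpair ω f f :=
  setIntegral_nonneg measurableSet_Ioi fun y hy =>
    mul_nonneg (h.pos y hy).le (mul_self_nonneg _)

theorem IsWeight.wpair_self_pos (h : IsWeight ω) {f : ℝ[X]} (hf : f ≠ 0) : 0 < wpair ω f f := by
  unfold wpair
  rw [setIntegral_pos_iff_support_of_nonneg_ae ?_ (h.int_mul f f)]
  · have hsub : Ioi (0 : ℝ) \ (f.roots.toFinset : Set ℝ) ⊆
        (Function.support fun x => ω x * (f.eval x * f.eval x)) ∩ Ioi 0 := by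
      rintro x ⟨hx, hr⟩
      refine ⟨?_, hx⟩
      have h0 : f.eval x ≠ 0 := fun h => hr (by simp [hf, h])
      exact mul_ne_zero (h.pos x hx).ne' (mul_ne_zero h0 h0)
    refine lt_of_lt_of_le ?_ (measure_mono hsub)
    rw [measure_sdiff_null (f.roots.toFinset.finite_toSet.measure_zero _)]
    simp
  · filter_upwards [ae_restrict_mem measurableSet_Ioi] with x hx
    exact mul_nonneg (h.pos x hx).le (mul_self_nonneg _)

theorem IsWeight.wpair_sq_le (h : IsWeight ω) (f g : ℝ[X]) :
    wpair ω f g ^ 2 ≤ wpair ω f f * wpair ω g g := by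
  by_cases hg : g = 0
  · subst hg; simp [wpair]
  have hp := h.wpair_self_pos hg
  have h0 := h.wpair_self_nonneg (wpair ω g g • f - wpair ω f g • g)
  rw [← h.form_apply] at h0
  simp only [map_sub, map_smul, LinearMap.sub_apply, LinearMap.smul_apply, smul_eq_mul,
    h.form_apply, wpair_comm ω g f] at h0
  have h1 : 0 ≤ wpair ω g g * (wpair ω f f * wpair ω g g - wpair ω f g ^ 2) := by
    linarith
  nlinarith [nonneg_of_mul_nonneg_right h1 hp]

/-- Linear functionals on polynomials of bounded degree are represented by the pairing. -/
theorem IsWeight.exists_repr (h : IsWeight ω) (n : ℕ) (L : ℝ[X] →ₗ[ℝ] ℝ) :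
    ∃ D : ℝ[X], D.natDegree ≤ n ∧ ∀ p : ℝ[X], p.natDegree ≤ n → wpair ω D p = L p := by
  let V := degreeLT ℝ (n + 1)
  have : FiniteDimensional ℝ V := (degreeLTEquiv ℝ (n + 1)).symm.finiteDimensional
  let T : V →ₗ[ℝ] Module.Dual ℝ V := h.form.domRestrict₁₂ V V
  -- Positive definiteness makes the form injective into the dual, and equality of dimensions makes
  -- it surjective.
  have hT : Function.Injective T := by
    rw [injective_iff_map_eq_zero]
    intro D hD
    by_contra hne
    have h1 := h.wpair_self_pos (f := D.1) (fun h0 => hne (Subtype.ext h0))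
    have h2 : T D D = 0 := by rw [hD]; rfl
    exact h1.ne' h2
  have hfr : Module.finrank ℝ V = Module.finrank ℝ (Module.Dual ℝ V) :=
    (Subspace.dual_finrank_eq).symm
  obtain ⟨D, hD⟩ := (LinearMap.injective_iff_surjective_of_finrank_eq_finrank hfr).1 hT
    (L.comp V.subtype)
  have key : ∀ p : ℝ[X], p ∈ V ↔ p.natDegree ≤ n := fun p => by
    rw [mem_degreeLT, ← Nat.lt_succ_iff]
    rcases eq_or_ne p 0 with rfl | hp
    · simp
    · rw [degree_eq_natDegree hp]; exact Nat.cast_lt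
  refine ⟨D.1, (key _).1 D.2, fun p hp => ?_⟩
  exact LinearMap.congr_fun hD ⟨p, (key p).2 hp⟩

end wpair

/-- The Laguerre weight of exponent `α` at scale `N`. -/
def uw (α N y : ℝ) : ℝ := y ^ α * Real.exp (-y / N)

/-- The deformed weight `y^m (y+s)^a e^{-y/N}`. -/
def vw (m : ℕ) (a s N y : ℝ) : ℝ := y ^ m * (y + s) ^ a * Real.exp (-y / N)

theorem integrableOn_rpow_mul_exp {β N : ℝ} (hβ : -1 < β) (hN : 0 < N) :
    IntegrableOn (fun y : ℝ => y ^ β * Real.exp (-y / N)) (Ioi 0) := by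
  have := integrableOn_rpow_mul_exp_neg_mul_rpow (s := β) (p := 1) (b := N⁻¹) hβ one_pos (by positivity)
  refine this.congr_fun (fun y _ => ?_) measurableSet_Ioi
  simp only [Real.rpow_one]
  congr 2
  rw [neg_div, div_eq_inv_mul, neg_mul]

theorem isWeight_uw {α N : ℝ} (hα : -1 < α) (hN : 0 < N) : IsWeight (uw α N) where
  pos y hy := mul_pos (Real.rpow_pos_of_pos hy _) (Real.exp_pos _)
  int f := by
    have h1 : ∀ i : ℕ, IntegrableOn (fun y => uw α N y * y ^ i) (Ioi 0) := fun i => by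
      have := integrableOn_rpow_mul_exp (β := α + i) (N := N) (by have := i.cast_nonneg (α := ℝ); linarith) hN
      refine this.congr_fun (fun y hy => ?_) measurableSet_Ioi
      simp only [uw]
      rw [Real.rpow_add hy, Real.rpow_natCast]
      ring
    have h2 : (fun y => uw α N y * f.eval y) =
        fun y => ∑ i ∈ f.support, f.coeff i * (uw α N y * y ^ i) := by
      ext y
      rw [eval_eq_sum, Polynomial.sum, Finset.mul_sum]
      exact Finset.sum_congr rfl fun i _ => by ring
    rw [h2]
    exact integrable_finsetSum _ fun i _ => (h1 i).const_mul _

theorem isWeight_vw (m : ℕ) (a : ℝ) {s N : ℝ} (hs : 0 < s) (hN : 0 < N) :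
    IsWeight (vw m a s N) where
  pos y hy := by
    have : 0 < y + s := by positivity
    unfold vw
    positivity
  int f := by
    have hw : ContinuousOn (fun x => vw m a s N x * f.eval x) (Ici 0) := by
      unfold vw
      refine ContinuousOn.mul (ContinuousOn.mul (ContinuousOn.mul (by fun_prop) ?_)
        (by fun_prop)) (by fun_prop)
      refine ContinuousOn.rpow_const (by fun_prop) ?_
      intro x hx
      left
      have : 0 ≤ x := hx
      positivity
    have hb : 0 < 1 / (4 * N) := by positivity
    refine integrable_of_isBigO_exp_neg (b := 1 / (2 * N)) (by positivity) hw ?_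
    have h1 : (fun x : ℝ => (x + s) ^ a) =O[atTop] fun x => Real.exp (1 / (4 * N) * x) := by
      have h := ((isLittleO_rpow_exp_pos_mul_atTop a hb).isBigO).comp_tendsto
        (tendsto_atTop_add_const_right atTop s tendsto_id)
      refine h.trans (Asymptotics.IsBigO.of_bound (Real.exp (1 / (4 * N) * s))
        (Eventually.of_forall fun x => ?_))
      simp only [Function.comp, id, Real.norm_eq_abs, Real.abs_exp, ← Real.exp_add]
      apply le_of_eq
      congr 1
      ring
    have h2 : (fun x : ℝ => (X ^ m * f).eval x) =O[atTop] fun x => Real.exp (1 / (4 * N) * x) := by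
      have h := Polynomial.isBigO_atTop_of_degree_le (X ^ m * f) (X ^ (X ^ m * f).natDegree)
        (by rw [degree_X_pow]; exact degree_le_natDegree)
      refine h.trans ?_
      simpa using (isLittleO_pow_exp_pos_mul_atTop (X ^ m * f).natDegree hb).isBigO
    have h3 := ((h1.mul h2).mul (Asymptotics.isBigO_refl (fun x : ℝ => Real.exp (-x / N)) atTop))
    refine (h3.congr (fun x => ?_) (fun x => ?_))
    · simp only [vw, eval_mul, eval_pow, eval_X]
      ring
    · rw [← Real.exp_add, ← Real.exp_add]
      congr 1
      field_simp
      ring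

end

/-! ### The explicit Laguerre kernel: inversion of the moment matrix. -/

noncomputable section

/-- The left side is, up to sign, the k-th forward difference of the rising factorial x ↦
Γ(i+x)/Γ(x). Each difference lowers its degree by one and produces the next factor of the falling
factorial of i. -/
theorem sum_alternating_choose_mul_gamma_ratio (i : ℕ) (k : ℕ) {x : ℝ} (hx : 0 < x) :
    ∑ j ∈ Finset.range (k + 1), (-1 : ℝ) ^ j * k.choose j * (Real.Gamma (i + j + x) / Real.Gamma (j + x))
      = (-1) ^ k * i.descFactorial k * (Real.Gamma (i + x) / Real.Gamma (k + x)) := by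
  have key : ∀ k : ℕ, ∀ x : ℝ, 0 < x →
      (fwdDiff (1 : ℝ))^[k] (fun x : ℝ => Real.Gamma (i + x) / Real.Gamma x) x =
        i.descFactorial k * (Real.Gamma (i + x) / Real.Gamma (k + x)) := by
    intro k
    induction k with
    | zero => intro x _; simp
    | succ k ih =>
      intro x hx
      rw [Function.iterate_succ_apply', fwdDiff, ih x hx, ih (x + 1) (by linarith)]
      have hi : (0 : ℝ) < i + x := by positivity
      have hk : (0 : ℝ) < k + x := by positivity
      have h1 : Real.Gamma (i + (x + 1)) = (i + x) * Real.Gamma (i + x) := by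
        rw [← Real.Gamma_add_one hi.ne', add_assoc]
      have h2 : Real.Gamma (k + (x + 1)) = (k + x) * Real.Gamma (k + x) := by
        rw [← Real.Gamma_add_one hk.ne', add_assoc]
      have h3 : Real.Gamma ((k + 1 : ℕ) + x) = (k + x) * Real.Gamma (k + x) := by
        rw [← Real.Gamma_add_one hk.ne']; congr 1; push_cast; ring
      have h4 : ((i.descFactorial (k + 1) : ℕ) : ℝ) = ((i : ℝ) - k) * i.descFactorial k := by
        rw [Nat.descFactorial_succ, Nat.cast_mul]
        rcases le_or_gt k i with h | h
        · rw [Nat.cast_sub h]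
        · rw [Nat.descFactorial_of_lt h]; simp
      have h5 := (Real.Gamma_pos_of_pos hk).ne'
      rw [h1, h2, h3, h4]
      field_simp
      ring
  have h := key k x hx
  rw [fwdDiff_iter_eq_sum_shift] at h
  rw [mul_assoc, ← h, Finset.mul_sum]
  refine Finset.sum_congr rfl fun j hj => ?_
  have hjk : j ≤ k := Nat.lt_succ_iff.1 (Finset.mem_range.1 hj)
  have h6 : (-1 : ℝ) ^ k * (-1) ^ (k - j) = (-1) ^ j := by
    rw [← pow_add, show k + (k - j) = 2 * (k - j) + j by omega, pow_add, pow_mul]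
    simp
  simp only [nsmul_eq_mul, mul_one, zsmul_eq_mul]
  push_cast
  rw [← mul_assoc, ← mul_assoc, h6, add_comm x, add_assoc]

/-- The signed Pascal matrix is inverse to the Pascal matrix. -/
theorem sum_alternating_choose_mul_choose {l n : ℕ} (hl : l ≤ n) (j : ℕ) :
    ∑ k ∈ Finset.range (n + 1), (-1 : ℝ) ^ (j + k) * k.choose j * l.choose k
      = if l = j then 1 else 0 := by
  have h0 : ∑ k ∈ Finset.range (n + 1), (-1 : ℝ) ^ (j + k) * k.choose j * l.choose k =
      ∑ k ∈ Finset.Ico j (l + 1), (-1 : ℝ) ^ (j + k) * k.choose j * l.choose k := by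
    symm
    refine Finset.sum_subset (fun k hk => ?_) fun k _ hk => ?_
    · simp only [Finset.mem_Ico, Finset.mem_range] at hk ⊢; omega
    · simp only [Finset.mem_Ico, not_and_or, not_le, not_lt] at hk
      rcases hk with h | h
      · simp [Nat.choose_eq_zero_of_lt h]
      · simp [Nat.choose_eq_zero_of_lt (show l < k by omega)]
  rw [h0]
  rcases lt_or_ge l j with h | h
  · rw [Finset.Ico_eq_empty (by omega), Finset.sum_empty, if_neg h.ne]
  · rw [Finset.sum_Ico_eq_sum_range]
    have h1 := Int.alternating_sum_range_choose (n := l - j)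
    have h2 : ∀ m ∈ Finset.range (l + 1 - j),
        (-1 : ℝ) ^ (j + (j + m)) * (j + m).choose j * l.choose (j + m) =
          l.choose j * ((((-1) ^ m * ((l - j).choose m : ℕ) : ℤ)) : ℝ) := fun m hm => by
      have hm' : j + m ≤ l := by have := Finset.mem_range.1 hm; omega
      have h3 := Nat.choose_mul (n := l) (Nat.le_add_right j m)
      rw [Nat.add_sub_cancel_left] at h3
      have h4 : (l.choose (j + m) : ℝ) * (j + m).choose j = l.choose j * (l - j).choose m := by
        exact_mod_cast h3
      have h5 : (-1 : ℝ) ^ (j + (j + m)) = (-1) ^ m := by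
        rw [← add_assoc, pow_add, ← two_mul, pow_mul]; simp
      push_cast
      rw [h5]
      linear_combination (-1) ^ m * h4
    rw [Finset.sum_congr rfl h2, ← Finset.mul_sum, ← Int.cast_sum, show l + 1 - j = l - j + 1 by omega,
      h1]
    rcases eq_or_ne l j with rfl | hne
    · simp
    · rw [if_neg (by omega), if_neg hne]; simp

/-- Coefficients of the reproducing kernel of the Laguerre weight `y^(x-1) e^{-y}` on polynomials
of degree at most `n`. -/
def kernelCoeff (x : ℝ) (n i j : ℕ) : ℝ :=
  (-1) ^ (i + j) / (Real.Gamma (i + x) * Real.Gamma (j + x)) *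
    ∑ k ∈ Finset.range (n + 1), (k.choose i * k.choose j : ℝ) * (Real.Gamma (k + x) / k.factorial)

/-- The coefficients of Σ_k L_k(u) L_k(v)/h_k, with L_k the Laguerre polynomials and h_k their
squared norms, invert the moment matrix Γ(l+i+x). The sum over i is a finite difference, and the sum
over k is then Pascal inversion. -/
theorem sum_kernelCoeff_mul_gamma {x : ℝ} (hx : 0 < x) {l n : ℕ} (hl : l ≤ n) (j : ℕ) :
    ∑ i ∈ Finset.range (n + 1), kernelCoeff x n i j * Real.Gamma (l + i + x)
      = if l = j then 1 else 0 := by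
  have hG : ∀ m : ℕ, Real.Gamma (m + x) ≠ 0 := fun m => (Real.Gamma_pos_of_pos (by positivity)).ne'
  have h1 : ∀ i ∈ Finset.range (n + 1), kernelCoeff x n i j * Real.Gamma (l + i + x) =
      ∑ k ∈ Finset.range (n + 1), ((-1) ^ j / Real.Gamma (j + x) * (k.choose j : ℝ) *
        (Real.Gamma (k + x) / k.factorial)) *
        ((-1 : ℝ) ^ i * k.choose i * (Real.Gamma (l + i + x) / Real.Gamma (i + x))) := fun i _ => by
    rw [kernelCoeff, Finset.mul_sum, Finset.sum_mul]
    refine Finset.sum_congr rfl fun k _ => ?_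
    have := hG i
    have := hG j
    field_simp
    ring
  rw [Finset.sum_congr rfl h1, Finset.sum_comm]
  have h2 : ∀ k ∈ Finset.range (n + 1), ∑ i ∈ Finset.range (n + 1),
      ((-1) ^ j / Real.Gamma (j + x) * (k.choose j : ℝ) *
        (Real.Gamma (k + x) / k.factorial)) *
        ((-1 : ℝ) ^ i * k.choose i * (Real.Gamma (l + i + x) / Real.Gamma (i + x))) =
      Real.Gamma (l + x) / Real.Gamma (j + x) * ((-1 : ℝ) ^ (j + k) * k.choose j * l.choose k) := by
    intro k hk
    rw [← Finset.mul_sum]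
    have h3 : ∑ i ∈ Finset.range (n + 1),
        ((-1 : ℝ) ^ i * k.choose i * (Real.Gamma (l + i + x) / Real.Gamma (i + x))) =
        ∑ i ∈ Finset.range (k + 1),
        ((-1 : ℝ) ^ i * k.choose i * (Real.Gamma (l + i + x) / Real.Gamma (i + x))) := by
      symm
      refine Finset.sum_subset (fun i hi => ?_) fun i _ hi => ?_
      · simp only [Finset.mem_range] at hi hk ⊢; omega
      · rw [Finset.mem_range, not_lt] at hi
        simp [Nat.choose_eq_zero_of_lt (show k < i by omega)]
    rw [h3, sum_alternating_choose_mul_gamma_ratio l k hx, Nat.descFactorial_eq_factorial_mul_choose]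
    have := hG k
    have := hG j
    have := (Nat.cast_ne_zero (R := ℝ)).2 k.factorial_ne_zero
    push_cast
    field_simp
    ring
  rw [Finset.sum_congr rfl h2, ← Finset.mul_sum, sum_alternating_choose_mul_choose hl j]
  split_ifs with h
  · subst h; rw [mul_one, div_self (hG l)]
  · rw [mul_zero]

/-- The polynomial representing the `j`-th coefficient functional in the Laguerre weight. -/
def coeffRepr (α N : ℝ) (n j : ℕ) : ℝ[X] :=
  ∑ i ∈ Finset.range (n + 1), (kernelCoeff (α + 1) n i j * N ^ (-(i + j + (α + 1)) : ℝ)) • X ^ i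

theorem coeff_coeffRepr (α N : ℝ) (n i j : ℕ) :
    (coeffRepr α N n j).coeff i = kernelCoeff (α + 1) n i j * N ^ (-(i + j + (α + 1)) : ℝ) := by
  rw [coeffRepr, finsetSum_coeff]
  simp only [coeff_smul, coeff_X_pow, smul_eq_mul, mul_ite, mul_one, mul_zero, Finset.sum_ite_eq,
    Finset.mem_range]
  split_ifs with h
  · rfl
  · rw [kernelCoeff, Finset.sum_eq_zero, mul_zero, zero_mul]
    intro k hk
    rw [Finset.mem_range] at hk
    simp [Nat.choose_eq_zero_of_lt (show k < i by omega)]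

theorem natDegree_coeffRepr_le (α N : ℝ) (n j : ℕ) : (coeffRepr α N n j).natDegree ≤ n := by
  refine natDegree_sum_le_of_forall_le _ _ fun i hi => ?_
  refine (natDegree_smul_le _ _).trans ?_
  rw [natDegree_X_pow]
  exact Nat.lt_succ_iff.1 (Finset.mem_range.1 hi)

theorem wpair_uw_X_pow {α N : ℝ} (hα : -1 < α) (hN : 0 < N) (l i : ℕ) :
    wpair (uw α N) (X ^ l) (X ^ i) = N ^ (l + i + (α + 1) : ℝ) * Real.Gamma (l + i + (α + 1)) := by
  have h := Real.integral_rpow_mul_exp_neg_mul_Ioi (a := l + i + (α + 1)) (r := N⁻¹)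
    (by have : (0 : ℝ) ≤ l + i := by positivity
        linarith) (by positivity)
  rw [one_div, inv_inv] at h
  rw [← h, wpair]
  refine setIntegral_congr_fun measurableSet_Ioi fun y hy => ?_
  simp only [uw, eval_pow, eval_X]
  rw [show (l + i + (α + 1) - 1 : ℝ) = α + (l + i : ℕ) by push_cast; ring, Real.rpow_add hy,
    Real.rpow_natCast, pow_add, neg_div, div_eq_inv_mul]
  ring

theorem wpair_coeffRepr {α N : ℝ} (hα : -1 < α) (hN : 0 < N) {n : ℕ} (j : ℕ) {f : ℝ[X]}
    (hf : f.natDegree ≤ n) : wpair (uw α N) f (coeffRepr α N n j) = f.coeff j := by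
  have hw := isWeight_uw hα hN
  have h1 : ∀ l ≤ n, wpair (uw α N) (X ^ l) (coeffRepr α N n j) = if l = j then 1 else 0 := by
    intro l hl
    rw [← hw.form_apply, coeffRepr, map_sum]
    simp only [map_smul, smul_eq_mul]
    simp only [hw.form_apply, wpair_uw_X_pow hα hN]
    have h2 : ∀ i ∈ Finset.range (n + 1),
        kernelCoeff (α + 1) n i j * N ^ (-(i + j + (α + 1)) : ℝ) *
          (N ^ (l + i + (α + 1) : ℝ) * Real.Gamma (l + i + (α + 1))) =
        N ^ (l - j : ℝ) * (kernelCoeff (α + 1) n i j * Real.Gamma (l + i + (α + 1))) := fun i _ => by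
      have h3 : N ^ (l - j : ℝ) = N ^ (-(i + j + (α + 1)) : ℝ) * N ^ (l + i + (α + 1) : ℝ) := by
        rw [← Real.rpow_add hN]; congr 1; ring
      rw [h3]; ring
    rw [Finset.sum_congr rfl h2, ← Finset.mul_sum, sum_kernelCoeff_mul_gamma (by linarith) hl]
    split_ifs with h
    · subst h; simp
    · simp
  conv_lhs => rw [as_sum_range_C_mul_X_pow' f (Nat.lt_succ_of_le hf)]
  rw [← hw.form_apply, map_sum, LinearMap.sum_apply]
  simp only [← smul_eq_C_mul, map_smul, LinearMap.smul_apply, smul_eq_mul, hw.form_apply]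
  rw [Finset.sum_congr rfl fun l hl => by
    rw [h1 l (Nat.lt_succ_iff.1 (Finset.mem_range.1 hl))]]
  simp only [mul_ite, mul_one, mul_zero, Finset.sum_ite_eq', Finset.mem_range]
  split_ifs with h
  · rfl
  · exact (coeff_eq_zero_of_natDegree_lt (by omega)).symm

/-! ### Asymptotics and uniform bounds for the kernel coefficients. -/

/-- Partial sums of a sequence asymptotic to a power. -/
theorem tendsto_sum_div_rpow {u : ℕ → ℝ} {γ L : ℝ} (hγ : 0 < γ)
    (h : Tendsto (fun k : ℕ => u k / (k : ℝ) ^ (γ - 1)) atTop (𝓝 L)) :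
    Tendsto (fun n : ℕ => (∑ k ∈ Finset.range (n + 1), u k) / (n : ℝ) ^ γ) atTop (𝓝 (L / γ)) := by
  -- Stolz–Cesàro: g telescopes to n^γ and is asymptotic to γ k^(γ-1), so u is L/γ times g up to
  -- o(g), and this survives summation.
  set g : ℕ → ℝ := fun k => ((k + 1 : ℕ) : ℝ) ^ γ - (k : ℝ) ^ γ with hg
  have hgpos : ∀ k, 0 < g k := fun k =>
    sub_pos.2 (Real.rpow_lt_rpow (by positivity) (by push_cast; linarith) hγ)
  have hgsum : ∀ n, ∑ k ∈ Finset.range n, g k = (n : ℝ) ^ γ := fun n => by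
    rw [Finset.sum_range_sub (fun k : ℕ => (k : ℝ) ^ γ)]
    simp [Real.zero_rpow hγ.ne']
  have hinv : Tendsto (fun k : ℕ => ((k : ℝ))⁻¹) atTop (𝓝[≠] 0) :=
    (tendsto_inv_atTop_nhdsGT_zero.comp tendsto_natCast_atTop_atTop).mono_right
      (nhdsWithin_mono _ fun y hy => ne_of_gt hy)
  have hgas : Tendsto (fun k : ℕ => g k / (k : ℝ) ^ (γ - 1)) atTop (𝓝 γ) := by
    have hd : HasDerivAt (fun y : ℝ => y ^ γ) γ 1 := by
      simpa using Real.hasDerivAt_rpow_const (x := 1) (p := γ) (Or.inl one_ne_zero)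
    have h1 := (hasDerivAt_iff_tendsto_slope_zero.1 hd).comp hinv
    refine h1.congr' ?_
    filter_upwards [eventually_gt_atTop 0] with k hk
    have hk' : (0 : ℝ) < k := Nat.cast_pos.2 hk
    have h2 : (1 + (k : ℝ)⁻¹) = (k + 1) / k := by field_simp
    simp only [Function.comp, smul_eq_mul, inv_inv, Real.one_rpow, hg]
    rw [h2, Real.div_rpow (by positivity) hk'.le, Real.rpow_sub_one hk'.ne']
    push_cast
    field_simp
  have hlo : (fun k => u k - L / γ * g k) =o[atTop] g := by
    refine (Asymptotics.isLittleO_iff_tendsto fun k hk => absurd hk (hgpos k).ne').2 ?_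
    have h1 := (h.div hgas hγ.ne').sub_const (L / γ)
    rw [sub_self] at h1
    refine h1.congr' ?_
    filter_upwards [eventually_gt_atTop 0] with k hk
    have hk' : (0 : ℝ) < (k : ℝ) ^ (γ - 1) := Real.rpow_pos_of_pos (Nat.cast_pos.2 hk) _
    have := (hgpos k).ne'
    simp only [Pi.div_apply]
    field_simp
  have h2 := hlo.sum_range (fun k => (hgpos k).le) (by
    simp only [hgsum]
    exact (tendsto_rpow_atTop hγ).comp tendsto_natCast_atTop_atTop)
  simp only [hgsum, Finset.sum_sub_distrib, ← Finset.mul_sum] at h2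
  have h3 := (h2.tendsto_div_nhds_zero.add_const (L / γ)).comp (tendsto_add_atTop_nat 1)
  rw [zero_add] at h3
  have h4 : Tendsto (fun n : ℕ => (1 + (n : ℝ)⁻¹) ^ γ) atTop (𝓝 1) := by
    have := ((hinv.mono_right nhdsWithin_le_nhds).const_add 1).rpow_const (p := γ)
      (Or.inr hγ.le)
    simpa using this
  have h5 := h3.mul h4
  rw [mul_one] at h5
  refine h5.congr' ?_
  filter_upwards [eventually_gt_atTop 0] with n hn
  have hn' : (0 : ℝ) < n := Nat.cast_pos.2 hn
  have h6 : (1 + (n : ℝ)⁻¹) = (n + 1) / n := by field_simp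
  have h7 : (0 : ℝ) < ((n : ℝ) + 1) ^ γ := by positivity
  have h8 : (0 : ℝ) < (n : ℝ) ^ γ := by positivity
  simp only [Function.comp]
  rw [h6, Real.div_rpow (by positivity) hn'.le]
  push_cast
  field_simp
  ring

/-- Euler's limit formula for Γ(x), with the product x(x+1)⋯(x+n) written as Γ(n+1+x)/Γ(x). -/
theorem tendsto_gamma_ratio {x : ℝ} (hx : 0 < x) :
    Tendsto (fun k : ℕ => Real.Gamma (k + x) / k.factorial / (k : ℝ) ^ (x - 1)) atTop (𝓝 1) := by
  have hG := (Real.Gamma_pos_of_pos hx).ne'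
  have h0 : ∀ n : ℕ, ∏ j ∈ Finset.range n, (x + j) = Real.Gamma (n + x) / Real.Gamma x := fun n => by
    induction n with
    | zero => simp [hG]
    | succ n ih =>
      have hn : (n + x : ℝ) ≠ 0 := by positivity
      rw [Finset.prod_range_succ, ih, show ((n + 1 : ℕ) + x : ℝ) = n + x + 1 by push_cast; ring,
        Real.Gamma_add_one hn]
      ring
  have h1 := (Real.GammaSeq_tendsto_Gamma x).inv₀ hG
  have h2 := h1.const_mul (Real.Gamma x)
  rw [mul_inv_cancel₀ hG] at h2
  have h3 : Tendsto (fun n : ℕ => 1 + x * (n : ℝ)⁻¹) atTop (𝓝 1) := by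
    simpa using (tendsto_inv_atTop_nhds_zero_nat (𝕜 := ℝ)).const_mul x |>.const_add 1
  have h4 := h2.div h3 one_ne_zero
  rw [div_one] at h4
  refine h4.congr' ?_
  filter_upwards [eventually_gt_atTop 0] with n hn
  have hn' : (0 : ℝ) < n := Nat.cast_pos.2 hn
  have h5 : (n + x : ℝ) ≠ 0 := by positivity
  have h6 := (Nat.cast_ne_zero (R := ℝ)).2 n.factorial_ne_zero
  have h7 : (n : ℝ) ^ x ≠ 0 := (Real.rpow_pos_of_pos hn' _).ne'
  have h8 := (Real.Gamma_pos_of_pos (show (0 : ℝ) < n + x by positivity)).ne'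
  have h9 : 1 + x * (n : ℝ)⁻¹ = (n + x) / n := by field_simp
  simp only [Pi.div_apply]
  rw [Real.GammaSeq, h0, h9, show ((n + 1 : ℕ) + x : ℝ) = n + x + 1 by push_cast; ring,
    Real.Gamma_add_one h5, Real.rpow_sub_one hn'.ne']
  field_simp

theorem tendsto_choose_div_pow (i : ℕ) :
    Tendsto (fun k : ℕ => (k.choose i : ℝ) / (k : ℝ) ^ i) atTop (𝓝 (1 / i.factorial)) := by
  have := ProbabilityTheory.tendsto_choose_mul_pow_atTop (p := fun n => (n : ℝ)⁻¹) (r := 1) i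
    (tendsto_const_nhds.congr' (by
      filter_upwards [eventually_gt_atTop 0] with n hn
      rw [mul_inv_cancel₀ (Nat.cast_ne_zero.2 hn.ne')]))
  simpa [div_eq_mul_inv] using this

theorem tendsto_sum_choose_mul_gamma {x : ℝ} (hx : 0 < x) (i j : ℕ) :
    Tendsto (fun n : ℕ => (∑ k ∈ Finset.range (n + 1), (k.choose i * k.choose j : ℝ) *
      (Real.Gamma (k + x) / k.factorial)) / (n : ℝ) ^ (i + j + x)) atTop
      (𝓝 (1 / i.factorial * (1 / j.factorial) * 1 / (i + j + x))) := by
  refine tendsto_sum_div_rpow (by positivity) ?_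
  refine (((tendsto_choose_div_pow i).mul (tendsto_choose_div_pow j)).mul
    (tendsto_gamma_ratio hx)).congr' ?_
  filter_upwards [eventually_gt_atTop 0] with k hk
  have hk' : (0 : ℝ) < k := Nat.cast_pos.2 hk
  rw [show (i + j + x - 1 : ℝ) = (x - 1) + (i + j : ℕ) by push_cast; ring, Real.rpow_add hk',
    Real.rpow_natCast, pow_add]
  have := (Real.rpow_pos_of_pos hk' (x - 1)).ne'
  field_simp

/-- Hard-edge limits of the kernel coefficients. -/
def limitCoeff (α : ℝ) (i j : ℕ) : ℝ :=
  (-1) ^ (i + j) / (Real.Gamma (i + (α + 1)) * Real.Gamma (j + (α + 1))) *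
    ((1 / i.factorial * (1 / j.factorial) * 1 / (i + j + (α + 1))) * 4 ^ (-(i + j + (α + 1)) : ℝ))

theorem coeff_coeffRepr_eq (α : ℝ) {n : ℕ} (hn : 0 < n) (i j : ℕ) :
    (coeffRepr α (4 * n) n j).coeff i =
    (-1) ^ (i + j) / (Real.Gamma (i + (α + 1)) * Real.Gamma (j + (α + 1))) *
    ((∑ k ∈ Finset.range (n + 1), (k.choose i * k.choose j : ℝ) *
      (Real.Gamma (k + (α + 1)) / k.factorial)) / (n : ℝ) ^ (i + j + (α + 1)) *
      4 ^ (-(i + j + (α + 1)) : ℝ)) := by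
  have hn' : (0 : ℝ) < n := Nat.cast_pos.2 hn
  rw [coeff_coeffRepr, kernelCoeff, Real.mul_rpow (by norm_num) hn'.le, Real.rpow_neg hn'.le]
  ring

theorem tendsto_coeff_coeffRepr {α : ℝ} (hα : -1 < α) (i j : ℕ) :
    Tendsto (fun n : ℕ => (coeffRepr α (4 * n) n j).coeff i) atTop (𝓝 (limitCoeff α i j)) := by
  refine (((tendsto_sum_choose_mul_gamma (x := α + 1) (by linarith) i j).mul_const _).const_mul
    _).congr' ?_
  filter_upwards [eventually_gt_atTop 0] with n hn
  rw [coeff_coeffRepr_eq α hn]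

theorem limitCoeff_zero_pos {α : ℝ} (hα : -1 < α) : 0 < limitCoeff α 0 0 := by
  have h : 0 < α + 1 := by linarith
  have := Real.Gamma_pos_of_pos h
  simp only [limitCoeff, CharP.cast_eq_zero, zero_add, pow_zero, Nat.factorial_zero]
  positivity

/-- A summable majorant for the kernel coefficients. -/
theorem exists_coeffRepr_bound {α : ℝ} (hα : -1 < α) :
    ∃ b : ℕ → ℝ, (∀ j, 0 ≤ b j) ∧ (∀ r : ℝ, 0 ≤ r → Summable fun j => b j * r ^ j) ∧
      ∀ n : ℕ, 0 < n → ∀ j, (coeffRepr α (4 * n) n j).coeff j ≤ b j ^ 2 := by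
  have hx : 0 < α + 1 := by linarith
  have hGp : ∀ j : ℕ, 0 < Real.Gamma (j + (α + 1)) := fun j => Real.Gamma_pos_of_pos (by positivity)
  obtain ⟨A, hA⟩ := (tendsto_sum_choose_mul_gamma hx 0 0).bddAbove_range
  have hA' : ∀ n : ℕ, (∑ k ∈ Finset.range (n + 1), Real.Gamma (k + (α + 1)) / k.factorial) /
      (n : ℝ) ^ (α + 1) ≤ max A 1 := fun n => by
    refine le_trans ?_ (le_max_left _ _)
    simpa using hA ⟨n, rfl⟩
  -- The maximum with 1 only ensures positivity.
  set B := max A 1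
  have hB : 0 < B := lt_max_of_lt_right one_pos
  -- In the diagonal coefficient, C(k,j) ≤ n^j/j! pulls (n^j/j!)^2 out of the sum. The rest is at
  -- most B n^(α+1), the powers of n cancel and the power of 4 is at most 1, so b_j^2 = B/(j!
  -- Γ(j+α+1))^2 suffices.
  refine ⟨fun j => √B / (j.factorial * Real.Gamma (j + (α + 1))), fun j => ?_, fun r hr => ?_,
    fun n hn j => ?_⟩
  · have := hGp j
    positivity
  -- The ratio test needs nonzero terms, so r = 0 is separate.
  · rcases hr.eq_or_lt with rfl | hr
    · refine summable_of_ne_finset_zero (s := {0}) fun j hj => ?_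
      rw [zero_pow (by simpa using hj), mul_zero]
    refine summable_of_ratio_test_tendsto_lt_one (l := 0) one_pos
      (Eventually.of_forall fun j => ?_) ?_
    · have := hGp j
      have := Real.sqrt_pos.2 hB
      positivity
    · have h1 : Tendsto (fun j : ℕ => r * (1 / ((j : ℝ) + 1)) * (1 / ((j : ℝ) + (α + 1)))) atTop
          (𝓝 0) := by
        have h2 : Tendsto (fun j : ℕ => 1 / ((j : ℝ) + (α + 1))) atTop (𝓝 0) := by
          simp only [one_div]
          exact (tendsto_atTop_add_const_right _ _ tendsto_natCast_atTop_atTop).inv_tendsto_atTop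
        simpa using ((tendsto_one_div_add_atTop_nhds_zero_nat (𝕜 := ℝ)).const_mul r).mul h2
      refine h1.congr fun j => ?_
      have h3 := hGp j
      have h4 : (0 : ℝ) < j + (α + 1) := by positivity
      have h5 := Real.sqrt_pos.2 hB
      have h6 : Real.Gamma ((j + 1 : ℕ) + (α + 1)) =
          (j + (α + 1)) * Real.Gamma (j + (α + 1)) := by
        rw [← Real.Gamma_add_one h4.ne']; congr 1; push_cast; ring
      beta_reduce
      rw [h6, Nat.factorial_succ, Real.norm_of_nonneg (by positivity),
        Real.norm_of_nonneg (by positivity), pow_succ]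
      push_cast
      field_simp
  · have hn' : (0 : ℝ) < n := Nat.cast_pos.2 hn
    have hG := hGp j
    have h1 : (∑ k ∈ Finset.range (n + 1), (k.choose j * k.choose j : ℝ) *
        (Real.Gamma (k + (α + 1)) / k.factorial)) ≤ ((n : ℝ) ^ j / j.factorial) ^ 2 *
        ∑ k ∈ Finset.range (n + 1), Real.Gamma (k + (α + 1)) / k.factorial := by
      rw [Finset.mul_sum]
      refine Finset.sum_le_sum fun k hk => ?_
      have hk' : (k : ℝ) ≤ n := Nat.cast_le.2 (Nat.lt_succ_iff.1 (Finset.mem_range.1 hk))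
      have h2 : (k.choose j : ℝ) ≤ (n : ℝ) ^ j / j.factorial :=
        (Nat.choose_le_pow_div j k).trans (by gcongr)
      have h3 := (hGp k).le
      rw [← sq]
      gcongr
    have h2 : (4 : ℝ) ^ (-(j + j + (α + 1)) : ℝ) ≤ 1 :=
      Real.rpow_le_one_of_one_le_of_nonpos (by norm_num) (by
        have : (0 : ℝ) ≤ j := by positivity
        linarith)
    have h3 : (n : ℝ) ^ (j + j + (α + 1)) = (n : ℝ) ^ j * (n : ℝ) ^ j * (n : ℝ) ^ (α + 1) := by
      rw [Real.rpow_add hn', Real.rpow_add hn', Real.rpow_natCast]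
    have h0 : (-1 : ℝ) ^ (j + j) = 1 := by rw [← two_mul, pow_mul]; simp
    rw [coeff_coeffRepr_eq α hn, h0]
    calc _ ≤ 1 / (Real.Gamma (j + (α + 1)) * Real.Gamma (j + (α + 1))) *
          ((((n : ℝ) ^ j / j.factorial) ^ 2 *
          ∑ k ∈ Finset.range (n + 1), Real.Gamma (k + (α + 1)) / k.factorial) /
            (n : ℝ) ^ (j + j + (α + 1)) * 1) := by
          have : 0 ≤ ∑ k ∈ Finset.range (n + 1), Real.Gamma (k + (α + 1)) / k.factorial :=
            Finset.sum_nonneg fun k _ => by have := (hGp k).le; positivity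
          gcongr
      _ = 1 / (Real.Gamma (j + (α + 1)) * Real.Gamma (j + (α + 1))) * (1 / j.factorial ^ 2) *
          ((∑ k ∈ Finset.range (n + 1), Real.Gamma (k + (α + 1)) / k.factorial) /
            (n : ℝ) ^ (α + 1)) := by
          rw [h3]
          field_simp
      _ ≤ 1 / (Real.Gamma (j + (α + 1)) * Real.Gamma (j + (α + 1))) * (1 / j.factorial ^ 2) * B := by
          gcongr
          exact hA' n
      _ = _ := by
          rw [div_pow, mul_pow, Real.sq_sqrt hB.le]
          field_simp

end

/-! ### Passing to the limit in integrals over the half line. -/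

noncomputable section

/-- A function on the half line which is locally bounded by `β` and has square integral at most `A`
with respect to the density `y^α`. -/
structure SqBounded (α A : ℝ) (β : ℝ → ℝ) (F : ℝ → ℝ) : Prop where
  meas : AEStronglyMeasurable F (volume.restrict (Ioi 0))
  bdd : ∀ y, 0 < y → |F y| ≤ β y
  int : IntegrableOn (fun y => y ^ α * F y ^ 2) (Ioi 0)
  le : ∫ y in Ioi (0 : ℝ), y ^ α * F y ^ 2 ≤ A

/-- A multiplier which is integrable near the origin and `O(1/y)` at infinity. -/
structure Decaying (α C : ℝ) (ρ : ℝ → ℝ) : Prop where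
  meas : Measurable ρ
  locInt : ∀ M, IntegrableOn (fun y => ρ y * y ^ α) (Ioc 0 M)
  decay : ∀ y, 1 ≤ y → |ρ y| ≤ C / y

variable {α A B C : ℝ} {β γ F G ρ : ℝ → ℝ}

theorem measurable_rpow_const' (α : ℝ) : Measurable fun y : ℝ => y ^ α :=
  measurable_id.pow_const α

/-- Fatou's lemma with a bound that varies with n. The convergent bound u is what later lets norms
be compared with their limits. -/
theorem integral_sq_le_of_tendsto {F : ℕ → ℝ → ℝ} {f : ℝ → ℝ} {u : ℕ → ℝ} {L : ℝ}
    (hm : ∀ n, AEStronglyMeasurable (F n) (volume.restrict (Ioi 0)))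
    (hi : ∀ n, IntegrableOn (fun y => y ^ α * F n y ^ 2) (Ioi 0))
    (hle : ∀ n, ∫ y in Ioi (0 : ℝ), y ^ α * F n y ^ 2 ≤ u n) (hu : Tendsto u atTop (𝓝 L))
    (hlim : ∀ y, 0 < y → Tendsto (fun n => F n y) atTop (𝓝 (f y))) :
    AEStronglyMeasurable f (volume.restrict (Ioi 0)) ∧
    IntegrableOn (fun y => y ^ α * f y ^ 2) (Ioi 0) ∧
    ∫ y in Ioi (0 : ℝ), y ^ α * f y ^ 2 ≤ L := by
  have hfm : AEStronglyMeasurable f (volume.restrict (Ioi 0)) :=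
    aestronglyMeasurable_of_tendsto_ae atTop hm
      ((ae_restrict_mem measurableSet_Ioi).mono fun y hy => hlim y hy)
  have hnn : ∀ g : ℝ → ℝ, 0 ≤ᵐ[volume.restrict (Ioi 0)] fun y => y ^ α * g y ^ 2 := fun g =>
    (ae_restrict_mem measurableSet_Ioi).mono fun y hy =>
      mul_nonneg (Real.rpow_nonneg (le_of_lt hy) _) (sq_nonneg _)
  have hfm2 : AEStronglyMeasurable (fun y => y ^ α * f y ^ 2) (volume.restrict (Ioi 0)) :=
    (measurable_rpow_const' α).aestronglyMeasurable.mul (hfm.pow 2)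
  have hL : 0 ≤ L := ge_of_tendsto' hu fun n => (integral_nonneg_of_ae (hnn _)).trans (hle n)
  have key : ∫⁻ y in Ioi (0 : ℝ), ENNReal.ofReal (y ^ α * f y ^ 2) ≤ ENNReal.ofReal L := by
    calc _ = ∫⁻ y in Ioi (0 : ℝ), liminf (fun n => ENNReal.ofReal (y ^ α * F n y ^ 2)) atTop := by
          refine setLIntegral_congr_fun measurableSet_Ioi fun y hy => ?_
          refine (Tendsto.liminf_eq ?_).symm
          exact (ENNReal.continuous_ofReal.tendsto _).comp (((hlim y hy).pow 2).const_mul _)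
      _ ≤ liminf (fun n => ∫⁻ y in Ioi (0 : ℝ), ENNReal.ofReal (y ^ α * F n y ^ 2)) atTop :=
          lintegral_liminf_le' fun n => (hi n).aemeasurable.ennreal_ofReal
      _ = liminf (fun n => ENNReal.ofReal (∫ y in Ioi (0 : ℝ), y ^ α * F n y ^ 2)) atTop := by
          congr 1
          ext n
          rw [ofReal_integral_eq_lintegral_ofReal (hi n) (hnn _)]
      _ ≤ liminf (fun n => ENNReal.ofReal (u n)) atTop :=
          liminf_le_liminf (Eventually.of_forall fun n => ENNReal.ofReal_le_ofReal (hle n))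
      _ = ENNReal.ofReal L := ((ENNReal.continuous_ofReal.tendsto _).comp hu).liminf_eq
  have hint : IntegrableOn (fun y => y ^ α * f y ^ 2) (Ioi 0) :=
    ⟨hfm2, (hasFiniteIntegral_iff_ofReal (hnn f)).2 (key.trans_lt ENNReal.ofReal_lt_top)⟩
  refine ⟨hfm, hint, ?_⟩
  rw [← ofReal_integral_eq_lintegral_ofReal hint (hnn f)] at key
  exact (ENNReal.ofReal_le_ofReal_iff hL).1 key

theorem SqBounded.of_tendsto {F : ℕ → ℝ → ℝ} {f : ℝ → ℝ} (h : ∀ n, SqBounded α A β (F n))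
    (hlim : ∀ y, 0 < y → Tendsto (fun n => F n y) atTop (𝓝 (f y))) : SqBounded α A β f := by
  obtain ⟨h1, h2, h3⟩ := integral_sq_le_of_tendsto (fun n => (h n).meas) (fun n => (h n).int)
    (fun n => (h n).le) tendsto_const_nhds hlim
  exact ⟨h1, fun y hy => le_of_tendsto' (hlim y hy).abs fun n => (h n).bdd y hy, h2, h3⟩

/-- On (0,1] the factors F, G are bounded and ρ y^α is integrable. Beyond 1 the multiplier is
bounded and |FG| ≤ F² + G². -/
theorem Decaying.integrable (hρ : Decaying α C ρ)
    (hFm : AEStronglyMeasurable F (volume.restrict (Ioi 0)))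
    (hGm : AEStronglyMeasurable G (volume.restrict (Ioi 0)))
    (hF : ∃ K, ∀ y, 0 < y → y ≤ 1 → |F y| ≤ K) (hG : ∃ K, ∀ y, 0 < y → y ≤ 1 → |G y| ≤ K)
    (hFi : IntegrableOn (fun y => y ^ α * F y ^ 2) (Ioi 0))
    (hGi : IntegrableOn (fun y => y ^ α * G y ^ 2) (Ioi 0)) :
    IntegrableOn (fun y => ρ y * y ^ α * (F y * G y)) (Ioi 0) := by
  have hm : AEStronglyMeasurable (fun y => ρ y * y ^ α * (F y * G y)) (volume.restrict (Ioi 0)) :=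
    (hρ.meas.mul (measurable_rpow_const' α)).aestronglyMeasurable.mul (hFm.mul hGm)
  rw [← Ioc_union_Ioi_eq_Ioi (zero_le_one (α := ℝ))]
  refine IntegrableOn.union ?_ ?_
  · obtain ⟨K, hK⟩ := hF
    obtain ⟨K', hK'⟩ := hG
    refine Integrable.mono' ((hρ.locInt 1).norm.mul_const (|K| * |K'|))
      (hm.mono_set Ioc_subset_Ioi_self) ?_
    refine (ae_restrict_mem measurableSet_Ioc).mono fun y hy => ?_
    rw [norm_mul, norm_mul (F y)]
    have := (hK y hy.1 hy.2).trans (le_abs_self K)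
    have := (hK' y hy.1 hy.2).trans (le_abs_self K')
    simp only [Real.norm_eq_abs] at *
    gcongr
  · have hs : Ioi (1 : ℝ) ⊆ Ioi 0 := Ioi_subset_Ioi zero_le_one
    refine Integrable.mono' (((hFi.mono_set hs).add (hGi.mono_set hs)).const_mul |C|)
      (hm.mono_set hs) ?_
    refine (ae_restrict_mem measurableSet_Ioi).mono fun y hy => ?_
    have hy1 : (1 : ℝ) ≤ y := le_of_lt hy
    have hp : 0 ≤ y ^ α := Real.rpow_nonneg (by linarith) _
    have h1 : |ρ y| ≤ |C| := (hρ.decay y hy1).trans ((div_le_div_of_nonneg_right (le_abs_self C)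
      (by linarith)).trans (div_le_self (abs_nonneg C) hy1))
    simp only [Pi.add_apply, Real.norm_eq_abs]
    rw [abs_mul, abs_mul, abs_of_nonneg hp, ← mul_add, mul_assoc]
    have h2 : |F y * G y| ≤ F y ^ 2 + G y ^ 2 := by
      rw [abs_le]
      constructor <;> nlinarith [sq_nonneg (F y + G y), sq_nonneg (F y - G y)]
    gcongr

theorem SqBounded.bddNearZero (h : SqBounded α A β F) (hβ : MonotoneOn β (Ici 0)) :
    ∃ K, ∀ y, 0 < y → y ≤ 1 → |F y| ≤ K :=
  ⟨β 1, fun y hy h1 => (h.bdd y hy).trans (hβ (le_of_lt hy) (zero_le_one (α := ℝ)) h1)⟩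

theorem Decaying.integrable_mul (hρ : Decaying α C ρ) (hβ : MonotoneOn β (Ici 0))
    (hγ : MonotoneOn γ (Ici 0)) (hF : SqBounded α A β F) (hG : SqBounded α B γ G) :
    IntegrableOn (fun y => ρ y * y ^ α * (F y * G y)) (Ioi 0) :=
  hρ.integrable hF.meas hG.meas (hF.bddNearZero hβ) (hG.bddNearZero hγ) hF.int hG.int

/-- The decay of ρ makes the tail small uniformly over `SqBounded` families; no pointwise domination
at infinity is required. -/
theorem Decaying.abs_integral_tail_le (hρ : Decaying α C ρ) (hC : 0 ≤ C)
    (hF : SqBounded α A β F) (hG : SqBounded α B γ G) {M : ℝ} (hM : 1 ≤ M) :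
    |∫ y in Ioi M, ρ y * y ^ α * (F y * G y)| ≤ C / M * (A + B) := by
  have hs : Ioi M ⊆ Ioi 0 := Ioi_subset_Ioi (by linarith)
  have hmono : ∀ {A : ℝ} {β F : ℝ → ℝ}, SqBounded α A β F →
      ∫ y in Ioi M, y ^ α * F y ^ 2 ≤ A := fun h =>
    (setIntegral_mono_set h.int ((ae_restrict_mem measurableSet_Ioi).mono fun y hy =>
      mul_nonneg (Real.rpow_nonneg (le_of_lt hy) _) (sq_nonneg _)) hs.eventuallyLE).trans h.le
  have h1 := norm_integral_le_of_norm_le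
    (((hF.int.mono_set hs).add (hG.int.mono_set hs)).const_mul (C / M))
    (f := fun y => ρ y * y ^ α * (F y * G y)) (μ := volume.restrict (Ioi M)) (by
      refine (ae_restrict_mem measurableSet_Ioi).mono fun y hy => ?_
      have hyM : M ≤ y := le_of_lt hy
      have hp : 0 ≤ y ^ α := Real.rpow_nonneg (by linarith) _
      have h1 : |ρ y| ≤ C / M := (hρ.decay y (hM.trans hyM)).trans (by gcongr)
      simp only [Pi.add_apply, Real.norm_eq_abs]
      rw [abs_mul, abs_mul, abs_of_nonneg hp, ← mul_add, mul_assoc]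
      have h2 : |F y * G y| ≤ F y ^ 2 + G y ^ 2 := by
        rw [abs_le]
        constructor <;> nlinarith [sq_nonneg (F y + G y), sq_nonneg (F y - G y)]
      gcongr)
  refine h1.trans ?_
  rw [integral_const_mul]
  refine mul_le_mul_of_nonneg_left ?_ (by positivity)
  rw [show (∫ y in Ioi M, ((fun y => y ^ α * F y ^ 2) + fun y => y ^ α * G y ^ 2) y) =
    (∫ y in Ioi M, y ^ α * F y ^ 2) + ∫ y in Ioi M, y ^ α * G y ^ 2 from
    integral_add (hF.int.mono_set hs) (hG.int.mono_set hs)]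
  exact add_le_add (hmono hF) (hmono hG)

theorem Decaying.abs_integral_le (hρ : Decaying α C ρ) (hC : 0 ≤ C) (hβ : MonotoneOn β (Ici 0))
    (hγ : MonotoneOn γ (Ici 0)) (hβ0 : 0 ≤ β 1) (hF : SqBounded α A β F) (hG : SqBounded α B γ G) :
    |∫ y in Ioi 0, ρ y * y ^ α * (F y * G y)| ≤
      (∫ y in Ioc (0 : ℝ) 1, |ρ y * y ^ α|) * (β 1 * γ 1) + C * (A + B) := by
  have hi := hρ.integrable_mul hβ hγ hF hG
  rw [← Ioc_union_Ioi_eq_Ioi (zero_le_one (α := ℝ)), setIntegral_union (by simp)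
    measurableSet_Ioi (hi.mono_set Ioc_subset_Ioi_self)
    (hi.mono_set (Ioi_subset_Ioi zero_le_one))]
  refine (abs_add_le _ _).trans (add_le_add ?_ ?_)
  · rw [← integral_mul_const]
    refine norm_integral_le_of_norm_le (f := fun y => ρ y * y ^ α * (F y * G y))
      (μ := volume.restrict (Ioc 0 1)) ((hρ.locInt 1).norm.mul_const _)
      ((ae_restrict_mem measurableSet_Ioc).mono fun y hy => ?_)
    rw [norm_mul, norm_mul (F y)]
    have := (hF.bdd y hy.1).trans (hβ (le_of_lt hy.1) (zero_le_one (α := ℝ)) hy.2)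
    have := (hG.bdd y hy.1).trans (hγ (le_of_lt hy.1) (zero_le_one (α := ℝ)) hy.2)
    simp only [Real.norm_eq_abs] at *
    gcongr
  · simpa using hρ.abs_integral_tail_le hC hF hG le_rfl

/-- Integrals against a decaying multiplier pass to the limit along pointwise convergent, locally
bounded and `L²`-bounded sequences. -/
theorem Decaying.tendsto_integral (hρ : Decaying α C ρ) (hC : 0 ≤ C) (hβ : MonotoneOn β (Ici 0))
    (hγ : MonotoneOn γ (Ici 0)) {F G : ℕ → ℝ → ℝ} {f g : ℝ → ℝ}
    (hF : ∀ n, SqBounded α A β (F n)) (hG : ∀ n, SqBounded α B γ (G n))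
    (hf : ∀ y, 0 < y → Tendsto (fun n => F n y) atTop (𝓝 (f y)))
    (hg : ∀ y, 0 < y → Tendsto (fun n => G n y) atTop (𝓝 (g y))) :
    Tendsto (fun n => ∫ y in Ioi 0, ρ y * y ^ α * (F n y * G n y)) atTop
      (𝓝 (∫ y in Ioi 0, ρ y * y ^ α * (f y * g y))) := by
  have hf' := SqBounded.of_tendsto hF hf
  have hg' := SqBounded.of_tendsto hG hg
  have hsplit : ∀ {f g : ℝ → ℝ}, SqBounded α A β f → SqBounded α B γ g → ∀ M : ℝ, 1 ≤ M →
      ∫ y in Ioi 0, ρ y * y ^ α * (f y * g y) = (∫ y in Ioc 0 M, ρ y * y ^ α * (f y * g y)) +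
        ∫ y in Ioi M, ρ y * y ^ α * (f y * g y) := fun hf hg M hM => by
    have hi := hρ.integrable_mul hβ hγ hf hg
    have hM0 : 0 ≤ M := by linarith
    rw [← Ioc_union_Ioi_eq_Ioi hM0, setIntegral_union (by simp) measurableSet_Ioi
      (hi.mono_set Ioc_subset_Ioi_self) (hi.mono_set (Ioi_subset_Ioi hM0))]
  -- On a bounded interval the majorants β and γ allow dominated convergence; the tails are handled
  -- by the uniform C/M bound.
  have hloc : ∀ M : ℝ, Tendsto (fun n => ∫ y in Ioc 0 M, ρ y * y ^ α * (F n y * G n y)) atTop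
      (𝓝 (∫ y in Ioc 0 M, ρ y * y ^ α * (f y * g y))) := fun M => by
    refine tendsto_integral_of_dominated_convergence
      (fun y => ‖ρ y * y ^ α‖ * (|β M| * |γ M|)) (fun n => ?_)
      ((hρ.locInt M).norm.mul_const _) (fun n => ?_) ?_
    · exact (((hρ.meas.mul (measurable_rpow_const' α)).aestronglyMeasurable.mul
        ((hF n).meas.mul (hG n).meas))).mono_set Ioc_subset_Ioi_self
    · refine (ae_restrict_mem measurableSet_Ioc).mono fun y hy => ?_
      rw [norm_mul, norm_mul (F n y)]
      have hM : 0 ≤ M := (le_of_lt hy.1).trans hy.2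
      have := (((hF n).bdd y hy.1).trans (hβ (le_of_lt hy.1) hM hy.2)).trans (le_abs_self _)
      have := (((hG n).bdd y hy.1).trans (hγ (le_of_lt hy.1) hM hy.2)).trans (le_abs_self _)
      simp only [Real.norm_eq_abs] at *
      gcongr
    · exact (ae_restrict_mem measurableSet_Ioc).mono fun y hy =>
        ((hf y hy.1).mul (hg y hy.1)).const_mul _
  rw [Metric.tendsto_atTop]
  intro ε hε
  have h1 : Tendsto (fun M : ℝ => C / M * (A + B)) atTop (𝓝 0) := by
    simpa using (tendsto_const_nhds (x := C)).div_atTop tendsto_id |>.mul_const (A + B)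
  obtain ⟨M, hM, hMε⟩ := ((eventually_ge_atTop 1).and
    (h1.eventually (gt_mem_nhds (show 0 < ε / 3 by positivity)))).exists
  obtain ⟨n₀, hn₀⟩ := (Metric.tendsto_atTop.1 (hloc M)) (ε / 3) (by positivity)
  refine ⟨n₀, fun n hn => ?_⟩
  have h2 := hn₀ n hn
  have h3 := (hρ.abs_integral_tail_le hC (hF n) (hG n) hM).trans_lt hMε
  have h4 := (hρ.abs_integral_tail_le hC hf' hg' hM).trans_lt hMε
  rw [hsplit (hF n) (hG n) M hM, hsplit hf' hg' M hM]
  rw [Real.dist_eq, abs_lt] at *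
  constructor <;> linarith [h2.1, h2.2, h3.1, h3.2, h4.1, h4.2]

end

/-! ### Entire majorants, bounded polynomial sequences and uniqueness for the limit equation. -/

noncomputable section

/-- Coefficients majorizing entire functions. -/
structure IsMajorant (b : ℕ → ℝ) : Prop where
  nonneg : ∀ j, 0 ≤ b j
  summable : ∀ r : ℝ, 0 ≤ r → Summable fun j => b j * r ^ j

/-- The sum of the power series with coefficients `c`. -/
def powerSum (c : ℕ → ℝ) (y : ℝ) : ℝ := ∑' j, c j * y ^ j

section powerSum

variable {b c : ℕ → ℝ} {A : ℝ}

theorem IsMajorant.const_mul (hb : IsMajorant b) (hA : 0 ≤ A) : IsMajorant fun j => A * b j :=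
  ⟨fun j => mul_nonneg hA (hb.nonneg j), fun r hr => by
    simpa only [mul_assoc] using (hb.summable r hr).mul_left A⟩

theorem IsMajorant.summable_mul (hb : IsMajorant b) (hc : ∀ j, |c j| ≤ b j) (y : ℝ) :
    Summable fun j => c j * y ^ j := by
  refine Summable.of_norm_bounded (hb.summable |y| (abs_nonneg y)) fun j => ?_
  rw [norm_mul, norm_pow, Real.norm_eq_abs, Real.norm_eq_abs]
  exact mul_le_mul_of_nonneg_right (hc j) (by positivity)

theorem IsMajorant.abs_powerSum_le (hb : IsMajorant b) (hc : ∀ j, |c j| ≤ b j) {y : ℝ}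
    (hy : 0 ≤ y) : |powerSum c y| ≤ powerSum b y := by
  rw [← Real.norm_eq_abs]
  refine tsum_of_norm_bounded (hb.summable y hy).hasSum fun j => ?_
  rw [norm_mul, norm_pow, Real.norm_eq_abs, Real.norm_eq_abs, abs_of_nonneg hy]
  exact mul_le_mul_of_nonneg_right (hc j) (by positivity)

theorem IsMajorant.monotoneOn (hb : IsMajorant b) : MonotoneOn (powerSum b) (Ici 0) :=
  fun x hx y hy hxy => (hb.summable x hx).tsum_le_tsum
    (fun j => mul_le_mul_of_nonneg_left (pow_le_pow_left₀ hx hxy j) (hb.nonneg j)) (hb.summable y hy)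

theorem IsMajorant.powerSum_nonneg (hb : IsMajorant b) {y : ℝ} (hy : 0 ≤ y) :
    0 ≤ powerSum b y :=
  tsum_nonneg fun j => mul_nonneg (hb.nonneg j) (pow_nonneg hy j)

theorem IsMajorant.tendsto_powerSum (hb : IsMajorant b) {c' : ℕ → ℕ → ℝ}
    (hc : ∀ n j, |c' n j| ≤ b j) (hl : ∀ j, Tendsto (fun n => c' n j) atTop (𝓝 (c j))) (y : ℝ) :
    Tendsto (fun n => powerSum (c' n) y) atTop (𝓝 (powerSum c y)) := by
  refine tendsto_tsum_of_dominated_convergence (hb.summable |y| (abs_nonneg y))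
    (fun j => (hl j).mul_const _) (Eventually.of_forall fun n j => ?_)
  rw [norm_mul, norm_pow, Real.norm_eq_abs, Real.norm_eq_abs]
  exact mul_le_mul_of_nonneg_right (hc n j) (by positivity)

theorem powerSum_sub {c' : ℕ → ℝ} (hb : IsMajorant b) (hc : ∀ j, |c j| ≤ b j)
    (hc' : ∀ j, |c' j| ≤ b j) (y : ℝ) :
    powerSum (fun j => c j - c' j) y = powerSum c y - powerSum c' y := by
  unfold powerSum
  rw [← (hb.summable_mul hc y).tsum_sub (hb.summable_mul hc' y)]
  simp only [sub_mul]

theorem powerSum_neg (c : ℕ → ℝ) (y : ℝ) : powerSum (fun j => -c j) y = -powerSum c y := by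
  unfold powerSum
  rw [← tsum_neg]
  simp only [neg_mul]

theorem powerSum_coeff (f : ℝ[X]) (y : ℝ) : powerSum f.coeff y = f.eval y := by
  rw [powerSum, tsum_eq_sum (s := Finset.range (f.natDegree + 1)), eval_eq_sum_range]
  intro j hj
  rw [Finset.mem_range, not_lt] at hj
  rw [coeff_eq_zero_of_natDegree_lt (by omega), zero_mul]

end powerSum

/-- The function `f` damped by the square root of the exponential factor at scale `4n`. -/
def damped (n : ℕ) (f : ℝ → ℝ) (y : ℝ) : ℝ := f y * Real.exp (-y / (2 * (4 * n)))

theorem damped_mul_damped (n : ℕ) (f g : ℝ → ℝ) (y : ℝ) :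
    damped n f y * damped n g y = f y * g y * Real.exp (-y / (4 * n)) := by
  unfold damped
  rw [mul_mul_mul_comm, ← Real.exp_add]
  congr 2
  field_simp
  ring

theorem abs_damped_le (n : ℕ) (f : ℝ → ℝ) {y : ℝ} (hy : 0 ≤ y) : |damped n f y| ≤ |f y| := by
  unfold damped
  rw [abs_mul, Real.abs_exp]
  refine mul_le_of_le_one_right (abs_nonneg _) (Real.exp_le_one_iff.2 ?_)
  rw [neg_div]
  have : 0 ≤ y / (2 * (4 * n)) := by positivity
  linarith

theorem tendsto_damped {φ : ℕ → ℕ} (hφ : Tendsto φ atTop atTop) {F : ℕ → ℝ → ℝ} {f : ℝ → ℝ} {y : ℝ}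
    (h : Tendsto (fun k => F k y) atTop (𝓝 (f y))) :
    Tendsto (fun k => damped (φ k) (F k) y) atTop (𝓝 (f y)) := by
  have h1 : Tendsto (fun k => -y / (2 * (4 * (φ k : ℝ)))) atTop (𝓝 0) := by
    refine tendsto_const_nhds.div_atTop ?_
    refine Tendsto.const_mul_atTop two_pos (Tendsto.const_mul_atTop four_pos ?_)
    exact tendsto_natCast_atTop_atTop.comp hφ
  have h2 := (Real.continuous_exp.tendsto _).comp h1
  rw [Real.exp_zero] at h2
  simpa [damped] using h.mul h2

/-- Sharing the exponential equally between the two factors turns the n-dependent norms into norms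
in one fixed space L²(y^α dy). -/
theorem uw_mul_eval (α : ℝ) (n : ℕ) (f g : ℝ[X]) (y : ℝ) :
    uw α (4 * n) y * (f.eval y * g.eval y) =
      y ^ α * (damped n f.eval y * damped n g.eval y) := by
  rw [damped_mul_damped, uw]
  ring

/-- The data of the kernel estimates: an exponent and an entire majorant of the Laguerre kernels. -/
structure KernelBound (α : ℝ) (b : ℕ → ℝ) : Prop extends IsMajorant b where
  hα : -1 < α
  bound : ∀ n : ℕ, 0 < n → ∀ j, (coeffRepr α (4 * n) n j).coeff j ≤ b j ^ 2

theorem exists_kernelBound {α : ℝ} (hα : -1 < α) : ∃ b, KernelBound α b := by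
  obtain ⟨b, h1, h2, h3⟩ := exists_coeffRepr_bound hα
  exact ⟨b, ⟨h1, h2⟩, hα, h3⟩

variable {α A B C : ℝ} {b : ℕ → ℝ}

theorem KernelBound.isWeight (h : KernelBound α b) {n : ℕ} (hn : 0 < n) :
    IsWeight (uw α (4 * n)) :=
  isWeight_uw h.hα (by positivity)

theorem KernelBound.wpair_coeffRepr_le (h : KernelBound α b) {n : ℕ} (hn : 0 < n) (j : ℕ) :
    wpair (uw α (4 * n)) (coeffRepr α (4 * n) n j) (coeffRepr α (4 * n) n j) ≤ b j ^ 2 := by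
  rw [wpair_coeffRepr h.hα (by positivity) j (natDegree_coeffRepr_le _ _ _ _)]
  exact h.bound n hn j

/-- Cauchy–Schwarz against the representer of the j-th coefficient, whose squared norm is its own
j-th coefficient. -/
theorem KernelBound.abs_coeff_le (h : KernelBound α b) {n : ℕ} (hn : 0 < n) {f : ℝ[X]}
    (hf : f.natDegree ≤ n) (hA : 0 ≤ A) (hfA : wpair (uw α (4 * n)) f f ≤ A ^ 2) (j : ℕ) :
    |f.coeff j| ≤ A * b j := by
  have h1 := (h.isWeight hn).wpair_sq_le f (coeffRepr α (4 * n) n j)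
  rw [wpair_coeffRepr h.hα (by positivity) j hf] at h1
  refine abs_le_of_sq_le_sq (h1.trans ?_) (mul_nonneg hA (h.nonneg j))
  rw [mul_pow]
  exact mul_le_mul hfA (h.wpair_coeffRepr_le hn j) ((h.isWeight hn).wpair_self_nonneg _)
    (sq_nonneg A)

theorem KernelBound.sqBounded (h : KernelBound α b) {n : ℕ} (hn : 0 < n) {f : ℝ[X]}
    (hf : f.natDegree ≤ n) (hA : 0 ≤ A) (hfA : wpair (uw α (4 * n)) f f ≤ A ^ 2) :
    SqBounded α (A ^ 2) (powerSum fun j => A * b j) (damped n f.eval) where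
  meas := by
    unfold damped
    exact (Continuous.aestronglyMeasurable (by fun_prop))
  bdd y hy := by
    refine (abs_damped_le n _ hy.le).trans ?_
    rw [← powerSum_coeff]
    exact (h.const_mul hA).abs_powerSum_le (h.abs_coeff_le hn hf hA hfA) hy.le
  int := by
    have := (h.isWeight hn).int_mul f f
    simp only [uw_mul_eval] at this
    simpa only [← sq] using this
  le := by
    simp only [wpair, uw_mul_eval] at hfA
    simpa only [← sq] using hfA

theorem SqBounded.damped (n : ℕ) {β f : ℝ → ℝ} (h : SqBounded α A β f) :
    SqBounded α A β (damped n f) := by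
  have hm : AEStronglyMeasurable (DeformedLaguerre.damped n f) (volume.restrict (Ioi 0)) := by
    unfold DeformedLaguerre.damped
    exact h.meas.mul (Continuous.aestronglyMeasurable (by fun_prop))
  have hle : ∀ y, 0 < y → y ^ α * DeformedLaguerre.damped n f y ^ 2 ≤ y ^ α * f y ^ 2 :=
    fun y hy => mul_le_mul_of_nonneg_left (sq_le_sq.2 (abs_damped_le n f hy.le))
      (Real.rpow_nonneg hy.le _)
  have hi : IntegrableOn (fun y => y ^ α * DeformedLaguerre.damped n f y ^ 2) (Ioi 0) := by
    refine Integrable.mono' h.int ((measurable_rpow_const' α).aestronglyMeasurable.mul (hm.pow 2)) ?_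
    refine (ae_restrict_mem measurableSet_Ioi).mono fun y hy => ?_
    rw [Real.norm_of_nonneg (mul_nonneg (Real.rpow_nonneg (le_of_lt hy) _) (sq_nonneg _))]
    exact hle y hy
  exact ⟨hm, fun y hy => (abs_damped_le n f hy.le).trans (h.bdd y hy), hi,
    (setIntegral_mono_on hi h.int measurableSet_Ioi hle).trans h.le⟩

/-- Bounded sequences of polynomials with convergent coefficients. -/
structure PolySeq (α A : ℝ) (φ : ℕ → ℕ) (f : ℕ → ℝ[X]) (c : ℕ → ℝ) : Prop where
  natDegree_le : ∀ k, (f k).natDegree ≤ φ k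
  norm_le : ∀ k, wpair (uw α (4 * φ k)) (f k) (f k) ≤ A ^ 2
  tendsto : ∀ j, Tendsto (fun k => (f k).coeff j) atTop (𝓝 (c j))

variable {φ : ℕ → ℕ} {f g : ℕ → ℝ[X]} {c d : ℕ → ℝ} {ρ : ℝ → ℝ}

theorem PolySeq.sqBounded_damped (h : PolySeq α A φ f c) (hb : KernelBound α b) (hA : 0 ≤ A)
    (hpos : ∀ k, 0 < φ k) (k : ℕ) :
    SqBounded α (A ^ 2) (powerSum fun j => A * b j) (damped (φ k) (f k).eval) :=
  hb.sqBounded (hpos k) (h.natDegree_le k) hA (h.norm_le k)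

theorem PolySeq.abs_le (h : PolySeq α A φ f c) (hb : KernelBound α b) (hA : 0 ≤ A)
    (hpos : ∀ k, 0 < φ k) (j : ℕ) : |c j| ≤ A * b j :=
  le_of_tendsto' (h.tendsto j).abs fun k =>
    hb.abs_coeff_le (hpos k) (h.natDegree_le k) hA (h.norm_le k) j

theorem PolySeq.tendsto_damped (h : PolySeq α A φ f c) (hb : KernelBound α b) (hA : 0 ≤ A)
    (hpos : ∀ k, 0 < φ k) (hφ : Tendsto φ atTop atTop) (y : ℝ) :
    Tendsto (fun k => damped (φ k) (f k).eval y) atTop (𝓝 (powerSum c y)) := by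
  refine DeformedLaguerre.tendsto_damped hφ ?_
  have h1 := (hb.const_mul hA).tendsto_powerSum
    (fun k j => hb.abs_coeff_le (hpos k) (h.natDegree_le k) hA (h.norm_le k) j) h.tendsto y
  simpa only [powerSum_coeff] using h1

theorem PolySeq.sqBounded (h : PolySeq α A φ f c) (hb : KernelBound α b) (hA : 0 ≤ A)
    (hpos : ∀ k, 0 < φ k) (hφ : Tendsto φ atTop atTop) :
    SqBounded α (A ^ 2) (powerSum fun j => A * b j) (powerSum c) :=
  SqBounded.of_tendsto (h.sqBounded_damped hb hA hpos)
    fun y _ => h.tendsto_damped hb hA hpos hφ y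

theorem PolySeq.tendsto_integral (hf : PolySeq α A φ f c) (hg : PolySeq α B φ g d)
    (hb : KernelBound α b) (hA : 0 ≤ A) (hB : 0 ≤ B) (hpos : ∀ k, 0 < φ k)
    (hφ : Tendsto φ atTop atTop) (hρ : Decaying α C ρ) (hC : 0 ≤ C) :
    Tendsto (fun k => ∫ y in Ioi 0, ρ y * (uw α (4 * φ k) y * ((f k).eval y * (g k).eval y))) atTop
      (𝓝 (∫ y in Ioi 0, ρ y * y ^ α * (powerSum c y * powerSum d y))) := by
  have := hρ.tendsto_integral hC (hb.const_mul hA).monotoneOn (hb.const_mul hB).monotoneOn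
    (hf.sqBounded_damped hb hA hpos) (hg.sqBounded_damped hb hB hpos)
    (fun y _ => hf.tendsto_damped hb hA hpos hφ y) (fun y _ => hg.tendsto_damped hb hB hpos hφ y)
  simpa only [uw_mul_eval, ← mul_assoc (ρ _) ((_ : ℝ) ^ α)] using this

theorem KernelBound.polySeq_coeffRepr (hb : KernelBound α b) (hpos : ∀ k, 0 < φ k)
    (hφ : Tendsto φ atTop atTop) (j : ℕ) :
    PolySeq α (b j) φ (fun k => coeffRepr α (4 * φ k) (φ k) j) (fun i => limitCoeff α i j) where
  natDegree_le _ := natDegree_coeffRepr_le _ _ _ _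
  norm_le k := hb.wpair_coeffRepr_le (hpos k) j
  tendsto i := (tendsto_coeff_coeffRepr hb.hα i j).comp hφ

/-- The homogeneous limit equation has only the zero solution. -/
theorem eq_zero_of_homogeneous (hb : KernelBound α b) (hρ : Decaying α C ρ) (hC : 0 ≤ C)
    (hpos : ∀ y, 0 < y → 0 < 1 + ρ y) (hA : 0 ≤ A)
    (hd : SqBounded α B (powerSum fun j => A * b j) (powerSum d))
    (heq : ∀ j, d j = -∫ y in Ioi 0, ρ y * y ^ α *
      (powerSum d y * powerSum (fun i => limitCoeff α i j) y)) (j : ℕ) : d j = 0 := by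
  -- The kernel estimates need a positive degree bound.
  set φ : ℕ → ℕ := fun k => k + 1 with hφdef
  have hφpos : ∀ k, 0 < φ k := fun k => Nat.succ_pos k
  have hφ : Tendsto φ atTop atTop := tendsto_add_atTop_nat 1
  have hmono := (hb.const_mul hA).monotoneOn
  have hnear : ∀ {f : ℝ → ℝ}, Continuous f → ∃ K, ∀ y, 0 < y → y ≤ 1 → |f y| ≤ K := fun {f} hf => by
    obtain ⟨K, hK⟩ := isCompact_Icc.exists_bound_of_continuousOn (s := Icc (0 : ℝ) 1) hf.continuousOn
    exact ⟨K, fun y h0 h1 => hK y ⟨h0.le, h1⟩⟩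
  have hpint : ∀ k (p : ℝ[X]), IntegrableOn
      (fun y => ρ y * y ^ α * (damped (φ k) (powerSum d) y * damped (φ k) p.eval y)) (Ioi 0) :=
    fun k p => by
    have hcont : Continuous (damped (φ k) p.eval) := by unfold damped; fun_prop
    refine hρ.integrable (hd.damped _).meas hcont.aestronglyMeasurable
      ((hd.damped _).bddNearZero hmono) (hnear hcont) (hd.damped _).int ?_
    have := (hb.isWeight (hφpos k)).int_mul p p
    simp only [uw_mul_eval] at this
    simpa only [← sq] using this
  -- The power series d need not be a polynomial, so the equation cannot be paired with d directly.
  -- The functional p ↦ ∫ ρ y^α d p, damped at scale 4φ(k), is represented by polynomials D_k; these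
  -- turn out to converge to -d.
  let L : ∀ k, ℝ[X] →ₗ[ℝ] ℝ := fun k =>
    { toFun := fun p => ∫ y in Ioi 0, ρ y * y ^ α *
        (damped (φ k) (powerSum d) y * damped (φ k) p.eval y)
      map_add' := fun p q => by
        rw [← integral_add (hpint k p) (hpint k q)]
        congr 1
        ext y
        simp only [damped, eval_add]
        ring
      map_smul' := fun r p => by
        rw [RingHom.id_apply, smul_eq_mul, ← integral_const_mul]
        congr 1
        ext y
        simp only [damped, eval_smul, smul_eq_mul]
        ring }
  have hL : ∀ k p, L k p = ∫ y in Ioi 0, ρ y * y ^ α *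
        (damped (φ k) (powerSum d) y * damped (φ k) p.eval y) := fun _ _ => rfl
  choose D hDdeg hD using fun k => (hb.isWeight (hφpos k)).exists_repr (φ k) (L k)
  obtain ⟨K, hK0, hK⟩ : ∃ K : ℝ, 0 ≤ K ∧ ∀ k (p : ℝ[X]), p.natDegree ≤ φ k →
      wpair (uw α (4 * φ k)) p p ≤ 1 ^ 2 → |L k p| ≤ K := by
    refine ⟨_, ?_, fun k p hp hp1 => hρ.abs_integral_le hC hmono
      (hb.const_mul zero_le_one).monotoneOn ((hb.const_mul hA).powerSum_nonneg zero_le_one)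
      (hd.damped _) (hb.sqBounded (hφpos k) hp zero_le_one hp1)⟩
    have h1 := (hb.const_mul hA).powerSum_nonneg zero_le_one
    have h2 := (hb.const_mul (zero_le_one (α := ℝ))).powerSum_nonneg zero_le_one
    have h3 : 0 ≤ ∫ y in Ioc (0 : ℝ) 1, |ρ y * y ^ α| := integral_nonneg fun y => abs_nonneg _
    have h4 : 0 ≤ B := le_trans (setIntegral_nonneg measurableSet_Ioi fun y hy =>
      mul_nonneg (Real.rpow_nonneg (le_of_lt hy) _) (sq_nonneg _)) hd.le
    positivity
  -- The uniform bound on L_k is tested on D_k divided by its norm.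
  have hDnorm : ∀ k, wpair (uw α (4 * φ k)) (D k) (D k) ≤ K ^ 2 := fun k => by
    set S := wpair (uw α (4 * φ k)) (D k) (D k) with hS
    rcases ((hb.isWeight (hφpos k)).wpair_self_nonneg (D k)).eq_or_lt with h0 | h0
    · rw [hS, ← h0]; positivity
    have hs := Real.sqrt_pos.2 h0
    have h1 := hK k ((√S)⁻¹ • D k) ((natDegree_smul_le _ _).trans (hDdeg k)) (by
      rw [wpair_smul_left, wpair_comm, wpair_smul_left, ← hS, one_pow, ← mul_assoc, ← sq, inv_pow,
        Real.sq_sqrt h0.le, inv_mul_cancel₀ h0.ne'])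
    rw [map_smul, ← hD k _ (hDdeg k), ← hS, smul_eq_mul, inv_mul_eq_div, Real.div_sqrt,
      abs_of_pos hs] at h1
    exact (Real.sqrt_le_left hK0).1 h1
  -- The j-th coefficient of D_k is L_k(E_j), which tends to ∫ ρ y^α d E_j = -d_j by the equation.
  have hseq : PolySeq α K φ D (fun j => -d j) := ⟨hDdeg, hDnorm, fun j => by
    have hE := hb.polySeq_coeffRepr hφpos hφ j
    have h1 := hρ.tendsto_integral hC hmono (hb.const_mul (hb.nonneg j)).monotoneOn
      (fun k => hd.damped (φ k)) (hE.sqBounded_damped hb (hb.nonneg j) hφpos)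
      (fun y _ => DeformedLaguerre.tendsto_damped hφ tendsto_const_nhds)
      (fun y _ => hE.tendsto_damped hb (hb.nonneg j) hφpos hφ y)
    rw [heq j, neg_neg]
    refine h1.congr fun k => ?_
    rw [← hL, ← hD k _ (natDegree_coeffRepr_le _ _ _ _),
      wpair_coeffRepr hb.hα (by have := hφpos k; positivity) j (hDdeg k)]⟩
  -- Here ‖D_k‖² = L_k(D_k), whose limit is -∫ ρ y^α d². Fatou then gives ∫ y^α d² ≤ -∫ ρ y^α d²,
  -- that is, ∫ (1+ρ) y^α d² ≤ 0.
  have hlim : Tendsto (fun k => wpair (uw α (4 * φ k)) (D k) (D k)) atTop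
      (𝓝 (∫ y in Ioi 0, ρ y * y ^ α * (powerSum d y * powerSum (fun j => -d j) y))) := by
    have h1 := hρ.tendsto_integral hC hmono (hb.const_mul hK0).monotoneOn
      (fun k => hd.damped (φ k)) (hseq.sqBounded_damped hb hK0 hφpos)
      (fun y _ => DeformedLaguerre.tendsto_damped hφ tendsto_const_nhds)
      (fun y _ => hseq.tendsto_damped hb hK0 hφpos hφ y)
    refine h1.congr fun k => ?_
    rw [← hL, ← hD k _ (hDdeg k)]
  obtain ⟨-, -, hfatou⟩ := integral_sq_le_of_tendsto (α := α)
    (fun k => (hseq.sqBounded_damped hb hK0 hφpos k).meas)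
    (fun k => (hseq.sqBounded_damped hb hK0 hφpos k).int)
    (fun k => le_of_eq (by simp only [wpair, uw_mul_eval]; simp only [← sq])) hlim
    (fun y _ => hseq.tendsto_damped hb hK0 hφpos hφ y)
  simp only [powerSum_neg, neg_sq, mul_neg, integral_neg] at hfatou
  have hint := hρ.integrable_mul hmono hmono hd hd
  have hint2 : IntegrableOn (fun y => (1 + ρ y) * (y ^ α * powerSum d y ^ 2)) (Ioi 0) := by
    refine (hd.int.add hint).congr (Eventually.of_forall fun y => ?_)
    simp only [Pi.add_apply]
    ring
  have hnn : 0 ≤ᵐ[volume.restrict (Ioi 0)] fun y => (1 + ρ y) * (y ^ α * powerSum d y ^ 2) :=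
    (ae_restrict_mem measurableSet_Ioi).mono fun y hy =>
      mul_nonneg (hpos y hy).le (mul_nonneg (Real.rpow_nonneg (le_of_lt hy) _) (sq_nonneg _))
  have hzero : ∫ y in Ioi 0, (1 + ρ y) * (y ^ α * powerSum d y ^ 2) = 0 := by
    refine le_antisymm ?_ (integral_nonneg_of_ae hnn)
    have h1 : ∫ y in Ioi 0, (1 + ρ y) * (y ^ α * powerSum d y ^ 2) =
        (∫ y in Ioi 0, y ^ α * powerSum d y ^ 2) +
          ∫ y in Ioi 0, ρ y * y ^ α * (powerSum d y * powerSum d y) := by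
      rw [← integral_add hd.int hint]
      congr 1
      ext y
      ring
    rw [h1]
    linarith
  have hae := (setIntegral_eq_zero_iff_of_nonneg_ae hnn hint2).1 hzero
  -- Vanishing of the series almost everywhere is fed back into the equation, which gives each d_j =
  -- 0.
  rw [heq j, neg_eq_zero]
  refine integral_eq_zero_of_ae ?_
  filter_upwards [hae, ae_restrict_mem measurableSet_Ioi] with y hy hy0
  have h1 := (hpos y hy0).ne'
  have h2 := (Real.rpow_pos_of_pos hy0 α).ne'
  have h3 : powerSum d y = 0 := by
    simpa [h1, h2] using hy
  simp [h3]

end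

/-! ### The shifted weight and convergence of its kernel at the origin. -/

noncomputable section

/-- The relative perturbation of the density `y^(m+a)` caused by the shift `s`. -/
def shiftPert (a s y : ℝ) : ℝ := ((y + s) / y) ^ a - 1

variable {a s : ℝ} {m : ℕ} {b : ℕ → ℝ}

theorem one_add_shiftPert_pos (a : ℝ) (hs : 0 < s) {y : ℝ} (hy : 0 < y) : 0 < 1 + shiftPert a s y := by
  unfold shiftPert
  have : 0 < ((y + s) / y) ^ a := by positivity
  linarith

theorem rpow_mul_one_add_shiftPert (m : ℕ) (a : ℝ) (hs : 0 < s) {y : ℝ} (hy : 0 < y) :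
    y ^ (m + a) * (1 + shiftPert a s y) = y ^ m * (y + s) ^ a := by
  have h1 : y ^ a ≠ 0 := (Real.rpow_pos_of_pos hy a).ne'
  rw [shiftPert, add_sub_cancel, Real.div_rpow (by positivity) hy.le, Real.rpow_add hy,
    Real.rpow_natCast]
  field_simp

theorem vw_eq (m : ℕ) (a : ℝ) (hs : 0 < s) (N : ℝ) {y : ℝ} (hy : 0 < y) :
    vw m a s N y = uw (m + a) N y * (1 + shiftPert a s y) := by
  rw [vw, uw, ← rpow_mul_one_add_shiftPert m a hs hy]
  ring

/-- Mean value inequality for (1+t)^a on [0,s], evaluated at t = s/y. -/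
theorem exists_abs_shiftPert_le (a : ℝ) (hs : 0 < s) :
    ∃ C, 0 ≤ C ∧ ∀ y, 1 ≤ y → |shiftPert a s y| ≤ C / y := by
  have hd : ∀ t ∈ Icc 0 s, HasDerivWithinAt (fun t : ℝ => (1 + t) ^ a) (1 * a * (1 + t) ^ (a - 1))
      (Icc 0 s) t := fun t ht =>
    (((hasDerivAt_id t).const_add 1).rpow_const (Or.inl (by
      have := ht.1
      simp only [id]
      positivity))).hasDerivWithinAt
  obtain ⟨K, hK⟩ := isCompact_Icc.exists_bound_of_continuousOn (s := Icc 0 s)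
    (f := fun t : ℝ => 1 * a * (1 + t) ^ (a - 1)) (by
      refine ContinuousOn.mul (by fun_prop) (ContinuousOn.rpow_const (by fun_prop) fun t ht => ?_)
      have := ht.1
      left
      positivity)
  have hK0 : 0 ≤ K := (norm_nonneg _).trans (hK 0 ⟨le_rfl, hs.le⟩)
  refine ⟨K * s, by positivity, fun y hy => ?_⟩
  have hy0 : 0 < y := by linarith
  have h1 := (convex_Icc 0 s).norm_image_sub_le_of_norm_hasDerivWithin_le hd hK
    (show (0 : ℝ) ∈ Icc 0 s from ⟨le_rfl, hs.le⟩)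
    (show s / y ∈ Icc 0 s from ⟨by positivity, div_le_self hs.le hy⟩)
  rw [add_zero, Real.one_rpow, sub_zero, Real.norm_eq_abs, Real.norm_eq_abs,
    abs_of_nonneg (show 0 ≤ s / y by positivity)] at h1
  rw [shiftPert, add_div, div_self hy0.ne']
  calc _ ≤ _ := h1
    _ = _ := by ring

theorem measurable_shiftPert (a s : ℝ) : Measurable (shiftPert a s) :=
  (((measurable_id.add_const s).div measurable_id).pow_const a).sub_const 1

theorem integrableOn_rpow_Ioc {α : ℝ} (hα : -1 < α) (M : ℝ) :
    IntegrableOn (fun y : ℝ => y ^ α) (Ioc 0 M) := by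
  rcases le_or_gt M 0 with h | h
  · rw [Ioc_eq_empty (not_lt.2 h)]; exact integrableOn_empty
  · exact (intervalIntegrable_iff_integrableOn_Ioc_of_le h.le).1
      (intervalIntegral.intervalIntegrable_rpow' hα)

theorem integrableOn_pow_mul_rpow_Ioc (m : ℕ) (a : ℝ) (hs : 0 < s) (M : ℝ) :
    IntegrableOn (fun y : ℝ => y ^ m * (y + s) ^ a) (Ioc 0 M) := by
  refine IntegrableOn.mono_set (t := Icc 0 M) (ContinuousOn.integrableOn_compact isCompact_Icc ?_)
    Ioc_subset_Icc_self
  refine ContinuousOn.mul (by fun_prop) (ContinuousOn.rpow_const (by fun_prop) fun t ht => ?_)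
  have := ht.1
  left
  positivity

/-- The perturbation may blow up at the origin, but its product with y^(m+a) is y^m (y+s)^a -
y^(m+a), a difference of integrable functions. -/
theorem exists_decaying_shiftPert (hα : -1 < m + a) (hs : 0 < s) :
    ∃ C, 0 ≤ C ∧ Decaying (m + a) C (shiftPert a s) := by
  obtain ⟨C, hC, h⟩ := exists_abs_shiftPert_le a hs
  refine ⟨C, hC, measurable_shiftPert a s, fun M => ?_, h⟩
  refine ((integrableOn_pow_mul_rpow_Ioc m a hs M).sub (integrableOn_rpow_Ioc hα M)).congr_fun
    (fun y hy => ?_) measurableSet_Ioc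
  simp only [Pi.sub_apply]
  rw [← rpow_mul_one_add_shiftPert m a hs hy.1]
  ring

/-- This multiplier produces the extra term ∫ s/(y+s) w g² of the integration by parts. -/
theorem exists_decaying_shift_ratio (m : ℕ) (a : ℝ) (hs : 0 < s) :
    ∃ C, 0 ≤ C ∧ Decaying (m + a) C (fun y => s / (y + s) * (1 + shiftPert a s y)) := by
  obtain ⟨C, hC, h⟩ := exists_abs_shiftPert_le a hs
  refine ⟨s * (1 + C), by positivity, ?_, fun M => ?_, fun y hy => ?_⟩
  · exact ((measurable_id.add_const s).const_div s).mul ((measurable_shiftPert a s).const_add 1)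
  · have h1 : IntegrableOn (fun y => s * (y ^ m * (y + s) ^ (a - 1))) (Ioc 0 M) :=
      (integrableOn_pow_mul_rpow_Ioc m (a - 1) hs M).const_mul s
    refine h1.congr_fun (fun y hy => ?_) measurableSet_Ioc
    have hys : 0 < y + s := add_pos hy.1 hs
    beta_reduce
    rw [mul_assoc, mul_comm (1 + _), rpow_mul_one_add_shiftPert m a hs hy.1,
      Real.rpow_sub_one hys.ne']
    ring
  · have hy0 : 0 < y := by linarith
    have h1 : |1 + shiftPert a s y| ≤ 1 + C := by
      refine (abs_add_le _ _).trans ?_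
      rw [abs_one]
      exact add_le_add le_rfl ((h y hy).trans (div_le_self hC hy))
    rw [abs_mul, abs_of_pos (show 0 < s / (y + s) by positivity)]
    calc _ ≤ s / y * (1 + C) := by
          gcongr
          linarith
      _ = _ := by ring

theorem exists_uw_le_vw (m : ℕ) (a : ℝ) (hs : 0 < s) {ε : ℝ} (hε : 0 < ε) :
    ∃ K, 0 < K ∧ ∀ N y, ε ≤ y → uw (m + a) N y ≤ K * vw m a s N y := by
  -- The summand 1 serves a ≥ 0 and the other serves a < 0, where the ratio of the weights is
  -- largest at y = ε.
  refine ⟨1 + ((ε + s) / ε) ^ (-a), by positivity, fun N y hy => ?_⟩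
  have hy0 : 0 < y := hε.trans_le hy
  have hu : 0 < uw (m + a) N y := mul_pos (Real.rpow_pos_of_pos hy0 _) (Real.exp_pos _)
  have hr : 1 ≤ (y + s) / y := by rw [le_div_iff₀ hy0]; linarith
  have h1 : 1 ≤ (1 + ((ε + s) / ε) ^ (-a)) * ((y + s) / y) ^ a := by
    have hp : 0 < ((y + s) / y) ^ a := by positivity
    have hq : 0 < ((ε + s) / ε) ^ (-a) := by positivity
    rcases le_or_gt 0 a with h | h
    · have := Real.one_le_rpow hr h
      nlinarith
    · have h2 : (y + s) / y ≤ (ε + s) / ε := by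
        rw [add_div, add_div, div_self hy0.ne', div_self hε.ne']
        gcongr
      have h3 : ((ε + s) / ε) ^ a ≤ ((y + s) / y) ^ a :=
        Real.rpow_le_rpow_of_nonpos (by positivity) h2 h.le
      have h4 : ((ε + s) / ε) ^ (-a) * ((ε + s) / ε) ^ a = 1 := by
        rw [← Real.rpow_add (by positivity), neg_add_cancel, Real.rpow_zero]
      nlinarith
  rw [vw_eq m a hs N hy0, shiftPert, add_sub_cancel]
  nlinarith

theorem KernelBound.abs_eval_le {α : ℝ} (hb : KernelBound α b) {n : ℕ} (hn : 0 < n) {f : ℝ[X]}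
    (hf : f.natDegree ≤ n) {y : ℝ} (hy : 0 ≤ y) (hy1 : y ≤ 1) :
    |f.eval y| ≤ √(wpair (uw α (4 * n)) f f) * powerSum b 1 := by
  set A := √(wpair (uw α (4 * n)) f f) with hA
  have hA0 : 0 ≤ A := Real.sqrt_nonneg _
  have hm := hb.const_mul hA0
  have h1 := hm.abs_powerSum_le (hb.abs_coeff_le hn hf hA0
    (Real.sq_sqrt ((hb.isWeight hn).wpair_self_nonneg f)).ge) hy
  rw [powerSum_coeff] at h1
  refine (h1.trans (hm.monotoneOn hy (zero_le_one (α := ℝ)) hy1)).trans_eq ?_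
  unfold powerSum
  rw [← tsum_mul_left]
  simp only [mul_assoc]

/-- On polynomials of degree at most `n` the Laguerre norm at scale `4n` is controlled by the
norm of the shifted weight, uniformly in `n`. -/
theorem exists_wpair_uw_le (hb : KernelBound (m + a) b) (hs : 0 < s) :
    ∃ K, 0 < K ∧ ∀ n : ℕ, 0 < n → ∀ f : ℝ[X], f.natDegree ≤ n →
      wpair (uw (m + a) (4 * n)) f f ≤ K * wpair (vw m a s (4 * n)) f f := by
  have hα1 : 0 < m + a + 1 := by linarith [hb.hα]
  set B := powerSum b 1
  have hlim : Tendsto (fun ε : ℝ => B ^ 2 * (ε ^ (m + a + 1) / (m + a + 1))) (𝓝[>] 0) (𝓝 0) := by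
    have h1 : Tendsto (fun ε : ℝ => ε ^ (m + a + 1)) (𝓝 0) (𝓝 0) := by
      have := (Real.continuousAt_rpow_const 0 (m + a + 1) (Or.inr hα1.le)).tendsto
      rwa [Real.zero_rpow hα1.ne'] at this
    simpa using ((h1.div_const (m + a + 1)).const_mul (B ^ 2)).mono_left nhdsWithin_le_nhds
  -- On [0,1] a polynomial is at most B times its Laguerre norm, so for small ε the part of the
  -- squared norm on (0,ε] is at most half of the whole and is absorbed. Beyond ε the weights are
  -- comparable.
  obtain ⟨ε, ⟨hεB, hε1⟩, hε0⟩ := ((hlim.eventually (gt_mem_nhds (show (0 : ℝ) < 1 / 2 by norm_num))).and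
    (mem_of_superset (Ioo_mem_nhdsGT (zero_lt_one (α := ℝ))) fun x hx => hx.2)).and
    self_mem_nhdsWithin |>.exists
  have hε0 : 0 < ε := hε0
  obtain ⟨K, hK, hKle⟩ := exists_uw_le_vw m a hs hε0
  refine ⟨2 * K, by positivity, fun n hn f hf => ?_⟩
  have hwu := hb.isWeight hn
  have hwv := isWeight_vw m a (N := 4 * n) hs (by positivity)
  set S := wpair (uw (m + a) (4 * n)) f f with hS
  have hS0 : 0 ≤ S := hwu.wpair_self_nonneg f
  have hsplit : S = (∫ y in Ioc 0 ε, uw (m + a) (4 * n) y * (f.eval y * f.eval y)) +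
      ∫ y in Ioi ε, uw (m + a) (4 * n) y * (f.eval y * f.eval y) := by
    rw [hS, wpair, ← Ioc_union_Ioi_eq_Ioi hε0.le, setIntegral_union (by simp) measurableSet_Ioi
      ((hwu.int_mul f f).mono_set Ioc_subset_Ioi_self)
      ((hwu.int_mul f f).mono_set (Ioi_subset_Ioi hε0.le))]
  have h1 : ∫ y in Ioc 0 ε, uw (m + a) (4 * n) y * (f.eval y * f.eval y) ≤ S * (1 / 2) := by
    calc _ ≤ ∫ y in Ioc 0 ε, y ^ (m + a) * (S * B ^ 2) := by
          refine setIntegral_mono_on ((hwu.int_mul f f).mono_set Ioc_subset_Ioi_self)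
            ((integrableOn_rpow_Ioc hb.hα ε).mul_const _) measurableSet_Ioc fun y hy => ?_
          have h2 := hb.abs_eval_le hn hf hy.1.le (hy.2.trans (le_of_lt hε1))
          have h3 : f.eval y * f.eval y ≤ S * B ^ 2 := by
            rw [← sq, ← sq_abs, ← Real.sq_sqrt hS0, ← mul_pow]
            gcongr
          have h4 : uw (m + a) (4 * n) y ≤ y ^ (m + a) := by
            refine mul_le_of_le_one_right (Real.rpow_nonneg hy.1.le _) (Real.exp_le_one_iff.2 ?_)
            rw [neg_div]
            have : 0 ≤ y / (4 * n) := by have := hy.1; positivity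
            linarith
          exact mul_le_mul h4 h3 (mul_self_nonneg _) (Real.rpow_nonneg hy.1.le _)
      _ = S * (B ^ 2 * (ε ^ (m + a + 1) / (m + a + 1))) := by
          rw [integral_mul_const, ← intervalIntegral.integral_of_le hε0.le,
            integral_rpow (Or.inl hb.hα), Real.zero_rpow hα1.ne', sub_zero]
          ring
      _ ≤ S * (1 / 2) := by gcongr
  have h2 : ∫ y in Ioi ε, uw (m + a) (4 * n) y * (f.eval y * f.eval y) ≤
      K * wpair (vw m a s (4 * n)) f f := by
    have hs' : Ioi ε ⊆ Ioi 0 := Ioi_subset_Ioi hε0.le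
    calc _ ≤ ∫ y in Ioi ε, K * (vw m a s (4 * n) y * (f.eval y * f.eval y)) := by
          refine setIntegral_mono_on ((hwu.int_mul f f).mono_set hs')
            (((hwv.int_mul f f).mono_set hs').const_mul K) measurableSet_Ioi fun y hy => ?_
          rw [← mul_assoc K]
          exact mul_le_mul_of_nonneg_right (hKle _ y (le_of_lt hy)) (mul_self_nonneg _)
      _ = K * ∫ y in Ioi ε, vw m a s (4 * n) y * (f.eval y * f.eval y) := integral_const_mul _ _
      _ ≤ _ := by
          refine mul_le_mul_of_nonneg_left ?_ hK.le
          refine setIntegral_mono_set (hwv.int_mul f f) ?_ hs'.eventuallyLE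
          exact (ae_restrict_mem measurableSet_Ioi).mono fun y hy =>
            mul_nonneg (hwv.pos y hy).le (mul_self_nonneg _)
  linarith

/-- `g` is the reproducing kernel at the origin of the shifted weight on polynomials of degree at
most `n`. -/
structure IsReprAtZero (m : ℕ) (a s : ℝ) (n : ℕ) (g : ℝ[X]) : Prop where
  natDegree_le : g.natDegree ≤ n
  wpair_eq : ∀ p : ℝ[X], p.natDegree ≤ n → wpair (vw m a s (4 * n)) g p = p.coeff 0

/-- Pair g with the Laguerre representer E_j. The shifted weight gives E_j(0), the Laguerre weight
gives the j-th coefficient of g, and the two weights differ by the factor 1 + ρ. -/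
theorem IsReprAtZero.coeff_add_integral (hb : KernelBound (m + a) b) (hs : 0 < s) {n : ℕ} (hn : 0 < n)
    {g : ℝ[X]} (hg : IsReprAtZero m a s n g) (j : ℕ) :
    g.coeff j + ∫ y in Ioi 0, shiftPert a s y * (uw (m + a) (4 * n) y *
      (g.eval y * (coeffRepr (m + a) (4 * n) n j).eval y)) =
      (coeffRepr (m + a) (4 * n) n j).coeff 0 := by
  have hE := natDegree_coeffRepr_le (m + a) (4 * n) n j
  have h1 := (hb.isWeight hn).int_mul g (coeffRepr (m + a) (4 * n) n j)
  have h2 := (isWeight_vw m a (N := 4 * n) hs (by positivity)).int_mul g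
    (coeffRepr (m + a) (4 * n) n j)
  rw [← hg.wpair_eq _ hE, ← wpair_coeffRepr hb.hα (by positivity : (0 : ℝ) < 4 * n) j hg.natDegree_le,
    wpair, wpair]
  refine (sub_eq_iff_eq_add'.1 ?_).symm
  rw [← integral_sub h2 h1]
  refine setIntegral_congr_fun measurableSet_Ioi fun y hy => ?_
  rw [vw_eq m a hs _ hy]
  ring

/-- With S the squared Laguerre norm of g, S ≤ K g(0) ≤ K √S b_0, hence √S ≤ K b_0. -/
theorem exists_wpair_bound (hb : KernelBound (m + a) b) (hs : 0 < s) :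
    ∃ A, 0 ≤ A ∧ ∃ K, 0 < K ∧ ∀ n : ℕ, 0 < n → ∀ g : ℝ[X], IsReprAtZero m a s n g →
      wpair (uw (m + a) (4 * n)) g g ≤ A ^ 2 ∧ wpair (uw (m + a) (4 * n)) g g ≤ K * g.coeff 0 := by
  obtain ⟨K, hK, hle⟩ := exists_wpair_uw_le hb hs
  refine ⟨K * b 0, mul_nonneg hK.le (hb.nonneg 0), K, hK, fun n hn g hg => ?_⟩
  have h1 := hle n hn g hg.natDegree_le
  rw [hg.wpair_eq g hg.natDegree_le] at h1
  refine ⟨?_, h1⟩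
  set S := wpair (uw (m + a) (4 * n)) g g with hS
  have hS0 : 0 ≤ S := (hb.isWeight hn).wpair_self_nonneg g
  have h2 := (le_abs_self _).trans (hb.abs_coeff_le hn hg.natDegree_le (Real.sqrt_nonneg S)
    (Real.sq_sqrt hS0).ge 0)
  have h3 : √S * √S ≤ √S * (K * b 0) := by
    rw [Real.mul_self_sqrt hS0]
    calc S ≤ K * g.coeff 0 := h1
      _ ≤ K * (√S * b 0) := by gcongr
      _ = _ := by ring
  have h4 : √S ≤ K * b 0 := by
    rcases (Real.sqrt_nonneg S).eq_or_lt with h | h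
    · rw [← h]; exact mul_nonneg hK.le (hb.nonneg 0)
    · exact le_of_mul_le_mul_left h3 h
  rw [← Real.sq_sqrt hS0]
  gcongr

/-- Hard-edge limit of the reproducing kernels at the origin of the shifted weight. -/
theorem exists_tendsto_coeff (hb : KernelBound (m + a) b) (hs : 0 < s) {g : ℕ → ℝ[X]}
    (hg : ∀ n, 0 < n → IsReprAtZero m a s n (g n)) :
    ∃ (A : ℝ) (c : ℕ → ℝ), 0 ≤ A ∧ (∀ n, 0 < n → ∀ j, |(g n).coeff j| ≤ A * b j) ∧
      (∀ j, Tendsto (fun n => (g n).coeff j) atTop (𝓝 (c j))) ∧ 0 < c 0 ∧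
      ∃ l, Tendsto (fun n : ℕ => ∫ y in Ioi 0, s / (y + s) *
        (vw m a s (4 * n) y * ((g n).eval y * (g n).eval y))) atTop (𝓝 l) := by
  obtain ⟨A, hA, K, hK, hbd⟩ := exists_wpair_bound hb hs
  obtain ⟨C, hC, hρ⟩ := exists_decaying_shiftPert hb.hα hs
  have hcoeff : ∀ n, 0 < n → ∀ j, |(g n).coeff j| ≤ A * b j := fun n hn =>
    hb.abs_coeff_le hn (hg n hn).natDegree_le hA (hbd n hn _ (hg n hn)).1
  have hseq : ∀ {φ : ℕ → ℕ} {c : ℕ → ℝ}, (∀ k, 0 < φ k) →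
      (∀ j, Tendsto (fun k => (g (φ k)).coeff j) atTop (𝓝 (c j))) →
      PolySeq (m + a) A φ (fun k => g (φ k)) c := fun hpos hc =>
    ⟨fun k => (hg _ (hpos k)).natDegree_le, fun k => (hbd _ (hpos k) _ (hg _ (hpos k))).1, hc⟩
  -- Every subsequential limit satisfies the limit equation.
  have hsol : ∀ {φ : ℕ → ℕ} {c : ℕ → ℝ}, (∀ k, 0 < φ k) → Tendsto φ atTop atTop →
      PolySeq (m + a) A φ (fun k => g (φ k)) c → ∀ j, c j + ∫ y in Ioi 0, shiftPert a s y *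
        y ^ (m + a) * (powerSum c y * powerSum (fun i => limitCoeff (m + a) i j) y) =
        limitCoeff (m + a) 0 j := fun {φ c} hpos hφ hc j => by
    have hE := hb.polySeq_coeffRepr hpos hφ j
    refine tendsto_nhds_unique ((hc.tendsto j).add
      (hc.tendsto_integral hE hb hA (hb.nonneg j) hpos hφ hρ hC)) ((hE.tendsto 0).congr fun k => ?_)
    exact ((hg _ (hpos k)).coeff_add_integral hb hs (hpos k) j).symm
  have huniq : ∀ {φ ψ : ℕ → ℕ} {c d : ℕ → ℝ}, (∀ k, 0 < φ k) → Tendsto φ atTop atTop →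
      (∀ k, 0 < ψ k) → Tendsto ψ atTop atTop → PolySeq (m + a) A φ (fun k => g (φ k)) c →
      PolySeq (m + a) A ψ (fun k => g (ψ k)) d → c = d := by
    intro φ ψ c d hφ hφ' hψ hψ' hc hd
    have hcs := hc.sqBounded hb hA hφ hφ'
    have hds := hd.sqBounded hb hA hψ hψ'
    have hca := hc.abs_le hb hA hφ
    have hda := hd.abs_le hb hA hψ
    have hbA := hb.const_mul hA
    have hps := powerSum_sub hbA hca hda
    have hmaj : ∀ j, |c j - d j| ≤ 2 * A * b j := fun j =>
      (abs_sub _ _).trans (by linarith [hca j, hda j])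
    have hmeas : AEStronglyMeasurable (powerSum fun j => c j - d j) (volume.restrict (Ioi 0)) :=
      (hcs.meas.sub hds.meas).congr (Eventually.of_forall fun y => (hps y).symm)
    have hint : IntegrableOn (fun y => y ^ (m + a) * powerSum (fun j => c j - d j) y ^ 2)
        (Ioi 0) := by
      refine Integrable.mono' ((hcs.int.add hds.int).const_mul 2)
        ((measurable_rpow_const' _).aestronglyMeasurable.mul (hmeas.pow 2)) ?_
      refine (ae_restrict_mem measurableSet_Ioi).mono fun y hy => ?_
      have hp : 0 ≤ y ^ (m + a) := Real.rpow_nonneg (le_of_lt hy) _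
      rw [Real.norm_of_nonneg (mul_nonneg hp (sq_nonneg _)), hps]
      simp only [Pi.add_apply]
      nlinarith [mul_nonneg hp (sq_nonneg (powerSum c y + powerSum d y))]
    have hsq : SqBounded (m + a) _ (powerSum fun j => 2 * A * b j) (powerSum fun j => c j - d j) :=
      ⟨hmeas, fun y hy => (hb.const_mul (by positivity)).abs_powerSum_le hmaj hy.le, hint, le_rfl⟩
    ext j
    refine sub_eq_zero.1 (eq_zero_of_homogeneous hb hρ hC
      (fun y hy => one_add_shiftPert_pos a hs hy) (by positivity) hsq (fun j => ?_) j)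
    have hE := (hb.polySeq_coeffRepr hφ hφ' j)
    have hEs := hE.sqBounded hb (hb.nonneg j) hφ hφ'
    have hi := fun {c : ℕ → ℝ} (h : SqBounded (m + a) (A ^ 2) (powerSum fun j => A * b j)
      (powerSum c)) => hρ.integrable_mul hbA.monotoneOn (hb.const_mul (hb.nonneg j)).monotoneOn h hEs
    have h1 : ∫ y in Ioi 0, shiftPert a s y * y ^ (m + a) * (powerSum (fun j => c j - d j) y *
        powerSum (fun i => limitCoeff (m + a) i j) y) =
        (∫ y in Ioi 0, shiftPert a s y * y ^ (m + a) * (powerSum c y *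
          powerSum (fun i => limitCoeff (m + a) i j) y)) -
        ∫ y in Ioi 0, shiftPert a s y * y ^ (m + a) * (powerSum d y *
          powerSum (fun i => limitCoeff (m + a) i j) y) := by
      rw [← integral_sub (hi hcs) (hi hds)]
      congr 1
      ext y
      rw [hps]
      ring
    rw [h1]
    linarith [hsol hφ hφ' hc j, hsol hψ hψ' hd j]
  -- Coefficient sequences live in a compact product of intervals; a unique cluster point forces
  -- convergence of the full sequence.
  set x : ℕ → ℕ → ℝ := fun n j => (g (n + 1)).coeff j with hx
  have hcpt : IsCompact (Set.pi univ fun j => Icc (-(A * b j)) (A * b j)) :=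
    isCompact_univ_pi fun j => isCompact_Icc
  have hxmem : ∀ n, x n ∈ Set.pi univ fun j => Icc (-(A * b j)) (A * b j) := fun n j _ =>
    abs_le.1 (hcoeff (n + 1) n.succ_pos j)
  have hsub : ∀ {ψ : ℕ → ℕ} {c : ℕ → ℝ}, StrictMono ψ → Tendsto (x ∘ ψ) atTop (𝓝 c) →
      Tendsto (fun k => ψ k + 1) atTop atTop ∧
      PolySeq (m + a) A (fun k => ψ k + 1) (fun k => g (ψ k + 1)) c := fun {ψ c} hψ hc =>
    ⟨(tendsto_add_atTop_nat 1).comp hψ.tendsto_atTop,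
      hseq (fun k => Nat.succ_pos _) (tendsto_pi_nhds.1 hc)⟩
  obtain ⟨c, -, ψ, hψ, hc⟩ := hcpt.tendsto_subseq hxmem
  have hlim : Tendsto x atTop (𝓝 c) := by
    refine hcpt.tendsto_nhds_of_unique_mapClusterPt (Eventually.of_forall hxmem) fun d _ hd => ?_
    obtain ⟨ψ', hψ', hd'⟩ := hd.tendsto_subseq
    exact huniq (fun k => Nat.succ_pos _) (hsub hψ' hd').1 (fun k => Nat.succ_pos _) (hsub hψ hc).1
      (hsub hψ' hd').2 (hsub hψ hc).2
  have hsuccpos : ∀ k : ℕ, 0 < k + 1 := Nat.succ_pos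
  have hsucc : Tendsto (fun k : ℕ => k + 1) atTop atTop := tendsto_add_atTop_nat 1
  have hfull : PolySeq (m + a) A (fun k => k + 1) (fun k => g (k + 1)) c :=
    hseq hsuccpos (tendsto_pi_nhds.1 hlim)
  refine ⟨A, c, hA, hcoeff, fun j => (tendsto_add_atTop_iff_nat 1).1 (hfull.tendsto j), ?_, ?_⟩
  · have h0 : ∀ k, 0 ≤ (g (k + 1)).coeff 0 := fun k => by
      rw [← (hg _ (hsuccpos k)).wpair_eq _ (hg _ (hsuccpos k)).natDegree_le]
      exact (isWeight_vw m a hs (by positivity)).wpair_self_nonneg _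
    -- If c 0 = 0, then ‖g‖² ≤ K g(0) → 0 and the limit series vanishes almost everywhere. The
    -- equation for j = 0 would then read 0 = `limitCoeff` 0 0, which is positive.
    refine (ge_of_tendsto' (hfull.tendsto 0) h0).lt_of_ne fun hc0 => ?_
    have hu : Tendsto (fun k => K * (g (k + 1)).coeff 0) atTop (𝓝 0) := by
      have := (hfull.tendsto 0).const_mul K
      rwa [← hc0, mul_zero] at this
    obtain ⟨-, hi, hle⟩ := integral_sq_le_of_tendsto (α := m + a)
      (fun k => (hfull.sqBounded_damped hb hA hsuccpos k).meas)
      (fun k => (hfull.sqBounded_damped hb hA hsuccpos k).int)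
      (fun k => by
        refine le_trans (le_of_eq ?_) (hbd _ (hsuccpos k) _ (hg _ (hsuccpos k))).2
        simp only [wpair, uw_mul_eval]
        simp only [← sq]) hu
      (fun y _ => hfull.tendsto_damped hb hA hsuccpos hsucc y)
    have hnn : 0 ≤ᵐ[volume.restrict (Ioi 0)] fun y => y ^ (m + a) * powerSum c y ^ 2 :=
      (ae_restrict_mem measurableSet_Ioi).mono fun y hy =>
        mul_nonneg (Real.rpow_nonneg (le_of_lt hy) _) (sq_nonneg _)
    have hae := (setIntegral_eq_zero_iff_of_nonneg_ae hnn hi).1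
      (le_antisymm hle (integral_nonneg_of_ae hnn))
    have heq := hsol hsuccpos hsucc hfull 0
    rw [← hc0, zero_add, integral_eq_zero_of_ae] at heq
    · exact (limitCoeff_zero_pos hb.hα).ne heq
    · filter_upwards [hae, ae_restrict_mem measurableSet_Ioi] with y hy hy0
      have h2 := (Real.rpow_pos_of_pos hy0 (m + a)).ne'
      have h3 : powerSum c y = 0 := by simpa [h2] using hy
      simp [h3]
  · obtain ⟨C', hC', hρ'⟩ := exists_decaying_shift_ratio m a hs
    refine ⟨_, (tendsto_add_atTop_iff_nat 1).1 ((hfull.tendsto_integral hfull hb hA hA hsuccpos hsucc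
      hρ' hC').congr fun k => ?_)⟩
    refine setIntegral_congr_fun measurableSet_Ioi fun y hy => ?_
    rw [vw_eq m a hs _ hy]
    ring

end

/-! ### Orthogonality, rescaling and integration by parts. -/

noncomputable section

variable {a s N : ℝ} {m n : ℕ}

theorem exists_isReprAtZero (m : ℕ) (a : ℝ) (hs : 0 < s) (hn : 0 < n) :
    ∃ g, IsReprAtZero m a s n g := by
  obtain ⟨g, h1, h2⟩ := (isWeight_vw m a (N := 4 * n) hs (by positivity)).exists_repr n (lcoeff ℝ 0)
  exact ⟨g, h1, h2⟩

/-- Moving a factor y from the weight to a polynomial turns representation at 0 into orthogonality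
for the next exponent. -/
theorem wpair_vw_succ (m : ℕ) (a s N : ℝ) (f g : ℝ[X]) :
    wpair (vw (m + 1) a s N) f g = wpair (vw m a s N) f (X * g) := by
  unfold wpair
  congr 1
  ext y
  simp only [vw, eval_mul, eval_X]
  ring

theorem degree_sub_C_mul_lt {p f : ℝ[X]} {d : ℕ} (hf : f.Monic) (hfd : f.natDegree = d)
    (hp : p.degree < (d + 1 : ℕ)) : (p - C (p.coeff d) * f).degree < d := by
  rw [degree_lt_iff_coeff_zero] at hp ⊢
  intro i hi
  rw [coeff_sub, coeff_C_mul]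
  rcases hi.eq_or_lt with rfl | hi
  · have : f.coeff d = 1 := by rw [← hfd]; exact hf
    rw [this, mul_one, sub_self]
  · have h0 : f.coeff i = 0 := coeff_eq_zero_of_natDegree_lt (by omega)
    rw [hp i hi, h0, mul_zero, sub_zero]

theorem pairing_monicPoly_of_degree_lt {t : ℝ} (a : ℝ) (ht : 0 < t) (n : ℕ) :
    ∀ d ≤ n, ∀ r : ℝ[X], r.degree < d → pairing a t r (monicPoly a t n) = 0 := by
  intro d
  induction d with
  | zero =>
    intro _ r hr
    rw [Nat.cast_zero, Nat.WithBot.lt_zero_iff, degree_eq_bot] at hr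
    simp [hr, pairing]
  | succ d ih =>
    intro hd r hr
    obtain ⟨h1, h2⟩ := monicPoly_natDegree_monic a t d
    have h3 := ih (by omega) _ (degree_sub_C_mul_lt h1 h2 hr)
    rw [pairing_sub a ht, pairing_C_mul, pairing_comm a t (monicPoly a t d),
      pairing_monicPoly_of_lt a ht n d (by omega), mul_zero, sub_zero] at h3
    exact h3

/-- A nonzero polynomial of degree at most `n` orthogonal to all polynomials of smaller degree
determines `Q_n`. -/
theorem Q_eq_of_orthogonal {t : ℝ} (a : ℝ) (ht : 0 < t) {P : ℝ[X]} (hP : P.natDegree ≤ n)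
    (hP0 : P ≠ 0) (horth : ∀ r : ℝ[X], r.degree < n → pairing a t P r = 0) (x : ℂ) :
    Q a n x t = aeval x P / aeval 0 P := by
  obtain ⟨h1, h2⟩ := monicPoly_natDegree_monic a t n
  have hdeg : (P - C (P.coeff n) * monicPoly a t n).degree < n :=
    degree_sub_C_mul_lt h1 h2 (degree_le_natDegree.trans_lt (Nat.cast_lt.2 (Nat.lt_succ_of_le hP)))
  have hPeq : P = C (P.coeff n) * monicPoly a t n := by
    by_contra hne
    refine (pairing_self_pos a ht (sub_ne_zero.2 hne)).ne' ?_
    rw [pairing_sub a ht, horth _ hdeg, pairing_C_mul, pairing_comm a t (monicPoly a t n),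
      pairing_monicPoly_of_degree_lt a ht n n le_rfl _ hdeg, mul_zero, sub_zero]
  have hc : P.coeff n ≠ 0 := fun h => hP0 (by rw [hPeq, h, C_0, zero_mul])
  have hs : (√(pairing a t (monicPoly a t n) (monicPoly a t n)))⁻¹ ≠ 0 :=
    inv_ne_zero (Real.sqrt_pos.2 (pairing_self_pos a ht h1.ne_zero)).ne'
  rw [hPeq, Q, orthoPoly]
  simp only [map_mul, aeval_C]
  rw [mul_div_mul_left _ _ (by simpa using hs), mul_div_mul_left _ _ (by simpa using hc)]

/-- Substitution x = y/N; the constant is irrelevant to orthogonality. -/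
theorem pairing_comp (a : ℝ) (hs : 0 < s) (hN : 0 < N) (P r : ℝ[X]) :
    pairing a (s / N) (P.comp (C N * X)) r =
      N⁻¹ * (N ^ 2 * N ^ a)⁻¹ * wpair (vw 2 a s N) P (r.comp (C N⁻¹ * X)) := by
  have h := integral_comp_mul_left_Ioi
    (fun x => weight a (s / N) x * ((P.comp (C N * X)).eval x * r.eval x)) 0 (inv_pos.2 hN)
  rw [mul_zero, inv_inv, smul_eq_mul] at h
  rw [pairing, wpair, mul_assoc, ← integral_const_mul, ← inv_mul_eq_iff_eq_mul₀ (inv_ne_zero hN.ne'),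
    inv_inv, ← h]
  refine setIntegral_congr_fun measurableSet_Ioi fun y hy => ?_
  have hy0 : 0 < y := hy
  have h1 : N⁻¹ * y + s / N = (y + s) / N := by field_simp
  have h2 : -(N⁻¹ * y) = -y / N := by field_simp
  simp only [weight, vw, eval_comp, eval_mul, eval_C, eval_X]
  rw [h1, h2, Real.div_rpow (by positivity) hN.le, mul_inv_cancel_left₀ hN.ne']
  have h3 := (Real.rpow_pos_of_pos hN a).ne'
  field_simp

theorem Q_scaled_eq (a : ℝ) (hs : 0 < s) (hN : 0 < N) {P : ℝ[X]} (hP : P.natDegree ≤ n)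
    (hP0 : P ≠ 0) (horth : ∀ r : ℝ[X], r.degree < n → wpair (vw 2 a s N) P r = 0) (z : ℂ) :
    Q a n (-z / N) (s / N) = aeval (-z) P / aeval 0 P := by
  have hd : ∀ {c : ℝ}, c ≠ 0 → (C c * X : ℝ[X]).natDegree = 1 := fun hc =>
    natDegree_C_mul_X _ hc
  have hdeg : ∀ {c : ℝ} (f : ℝ[X]), c ≠ 0 → (f.comp (C c * X)).natDegree = f.natDegree :=
    fun f hc => by rw [natDegree_comp, hd hc, mul_one]
  have hne : P.comp (C N * X) ≠ 0 := by
    intro h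
    refine hP0 ?_
    have h1 : (P.comp (C N * X)).comp (C N⁻¹ * X) = P := by
      rw [comp_assoc, mul_comp, C_comp, X_comp, ← mul_assoc, ← C_mul, mul_inv_cancel₀ hN.ne', C_1,
        one_mul, comp_X]
    rw [← h1, h, zero_comp]
  rw [Q_eq_of_orthogonal a (div_pos hs hN) (P := P.comp (C N * X)) (by rwa [hdeg P hN.ne']) hne]
  · have hNc : (N : ℂ) ≠ 0 := Complex.ofReal_ne_zero.2 hN.ne'
    simp only [aeval_comp, map_mul, aeval_C, aeval_X, Complex.coe_algebraMap, mul_zero]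
    rw [mul_div_cancel₀ _ hNc]
  · intro r hr
    rw [pairing_comp a hs hN, horth, mul_zero]
    rcases eq_or_ne r 0 with rfl | hr0
    · simp
    · refine degree_le_natDegree.trans_lt (Nat.cast_lt.2 ?_)
      rw [hdeg r (inv_ne_zero hN.ne')]
      exact (natDegree_lt_iff_degree_lt hr0).2 hr

/-- Integration by parts for the reproducing kernel at the origin of the weight without zero. -/
theorem IsReprAtZero.wpair_vw_one_self {g : ℝ[X]} (hs : 0 < s) (hn : 0 < n)
    (hg : IsReprAtZero 0 a s n g) :
    wpair (vw 1 a s (4 * n)) g g = 4 * n * ((1 + a) * g.coeff 0 - a * ∫ y in Ioi 0, s / (y + s) *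
        (vw 0 a s (4 * n) y * (g.eval y * g.eval y))) := by
  set N : ℝ := 4 * n with hNdef
  have hN : 0 < N := by positivity
  have hw0 := isWeight_vw 0 a hs hN
  have hw1 := isWeight_vw 1 a hs hN
  have hw2 := isWeight_vw 1 (a - 1) hs hN
  -- The function y w(y) g(y)² vanishes at both ends, so its derivative integrates to 0.
  have hderiv : ∀ y ∈ Ioi (0 : ℝ), HasDerivAt
      (fun y => vw 0 a s N y * (X * (g * g)).eval y)
      (vw 0 a s N y * (g.eval y * g.eval y) + a * (vw 1 (a - 1) s N y * (g.eval y * g.eval y)) -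
        N⁻¹ * (vw 1 a s N y * (g.eval y * g.eval y)) +
        2 * (vw 0 a s N y * (g.eval y * (X * derivative g).eval y))) y := by
    intro y hy
    have hys : 0 < y + s := add_pos hy hs
    have h1 : HasDerivAt (fun y => (y + s) ^ a) (1 * a * (y + s) ^ (a - 1)) y :=
      ((hasDerivAt_id y).add_const s).rpow_const (Or.inl hys.ne')
    have h2 : HasDerivAt (fun y => Real.exp (-y / N)) (Real.exp (-y / N) * (-1 / N)) y :=
      ((hasDerivAt_id y).neg.div_const N).exp
    have h3 := ((h1.mul h2).mul ((X * (g * g)).hasDerivAt y))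
    have h4 : (fun y => vw 0 a s N y * (X * (g * g)).eval y) =
        fun y => (y + s) ^ a * Real.exp (-y / N) * (X * (g * g)).eval y := by
      ext y
      simp [vw]
    rw [h4]
    refine h3.congr_deriv ?_
    simp only [Pi.mul_apply, vw, eval_mul, eval_X, derivative_mul, derivative_X, eval_add, eval_one, pow_zero,
      pow_one]
    field_simp
    ring
  have hint0 := hw0.int_mul g g
  have hint1 := hw1.int_mul g g
  have hint2 := hw2.int_mul g g
  have hint3 := hw0.int_mul g (X * derivative g)
  have hint4 : IntegrableOn (fun y => vw 0 a s N y * (g.eval y * g.eval y) +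
      a * (vw 1 (a - 1) s N y * (g.eval y * g.eval y))) (Ioi 0) := hint0.add (hint2.const_mul a)
  have hint5 : IntegrableOn (fun y => vw 0 a s N y * (g.eval y * g.eval y) +
      a * (vw 1 (a - 1) s N y * (g.eval y * g.eval y)) -
      N⁻¹ * (vw 1 a s N y * (g.eval y * g.eval y))) (Ioi 0) := hint4.sub (hint1.const_mul N⁻¹)
  have hint : IntegrableOn (fun y => vw 0 a s N y * (g.eval y * g.eval y) +
        a * (vw 1 (a - 1) s N y * (g.eval y * g.eval y)) -
        N⁻¹ * (vw 1 a s N y * (g.eval y * g.eval y)) +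
        2 * (vw 0 a s N y * (g.eval y * (X * derivative g).eval y))) (Ioi 0) :=
    hint5.add (hint3.const_mul 2)
  have hlim := tendsto_zero_of_hasDerivAt_of_integrableOn_Ioi hderiv hint (hw0.int (X * (g * g)))
  have hcont : ContinuousWithinAt (fun y => vw 0 a s N y * (X * (g * g)).eval y) (Ici 0) 0 := by
    unfold vw
    refine ContinuousAt.continuousWithinAt ?_
    have : ContinuousAt (fun y : ℝ => (y + s) ^ a) 0 :=
      ContinuousAt.rpow_const (by fun_prop) (Or.inl (by simpa using hs.ne'))
    fun_prop
  have hparts := integral_Ioi_of_hasDerivAt_of_tendsto hcont hderiv hint hlim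
  have hsum : ∫ y in Ioi (0 : ℝ), (vw 0 a s N y * (g.eval y * g.eval y) +
        a * (vw 1 (a - 1) s N y * (g.eval y * g.eval y)) -
        N⁻¹ * (vw 1 a s N y * (g.eval y * g.eval y)) +
        2 * (vw 0 a s N y * (g.eval y * (X * derivative g).eval y))) =
      wpair (vw 0 a s N) g g + a * wpair (vw 1 (a - 1) s N) g g - N⁻¹ * wpair (vw 1 a s N) g g +
        2 * wpair (vw 0 a s N) g (X * derivative g) := by
    unfold wpair
    rw [integral_add hint5 (hint3.const_mul 2), integral_sub hint4 (hint1.const_mul N⁻¹),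
      integral_add hint0 (hint2.const_mul a), integral_const_mul, integral_const_mul,
      integral_const_mul]
  -- Uses y/(y+s) = 1 - s/(y+s).
  have hJ : wpair (vw 1 (a - 1) s N) g g = wpair (vw 0 a s N) g g -
      ∫ y in Ioi 0, s / (y + s) * (vw 0 a s N y * (g.eval y * g.eval y)) := by
    rw [eq_sub_iff_add_eq', ← eq_sub_iff_add_eq]
    unfold wpair
    rw [← integral_sub hint0 hint2]
    refine setIntegral_congr_fun measurableSet_Ioi fun y hy => ?_
    have hys : 0 < y + s := add_pos hy hs
    simp only [vw, pow_zero, pow_one]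
    rw [Real.rpow_sub_one hys.ne']
    field_simp
    ring
  -- The polynomial y g' has degree at most n and vanishes at 0, so the representing property kills
  -- this term.
  have hder : wpair (vw 0 a s N) g (X * derivative g) = 0 := by
    rw [hg.wpair_eq, coeff_X_mul_zero]
    have h1 := natDegree_derivative_le g
    have h2 := hg.natDegree_le
    have h3 : (X * derivative g).natDegree ≤ 1 + (derivative g).natDegree :=
      natDegree_mul_le.trans (by rw [natDegree_X])
    omega
  rw [hsum, hder, hJ, hg.wpair_eq g hg.natDegree_le] at hparts
  simp only [eval_mul, eval_X, zero_mul, mul_zero, sub_zero, add_zero] at hparts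
  have hinv : N * N⁻¹ = 1 := mul_inv_cancel₀ hN.ne'
  linear_combination (-N) * hparts - wpair (vw 1 a s N) g g * hinv

end

/-! ### Kernel formulas for Q_n and R_n, and their limits. -/

noncomputable section

variable {a s : ℝ} {m n : ℕ}

theorem IsReprAtZero.Q_eq {g : ℝ[X]} (hs : 0 < s) (hn : 0 < n) (hg : IsReprAtZero 1 a s n g)
    (h0 : 0 < g.coeff 0) (z : ℂ) :
    Q a n (-z / (4 * n)) (s / (4 * n)) = aeval (-z) g / g.coeff 0 := by
  have h := Q_scaled_eq (N := 4 * n) a hs (by positivity) hg.natDegree_le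
    (fun h => by simp [h] at h0) (fun r hr => ?_) z
  · rw [← coeff_zero_eq_aeval_zero'] at h
    push_cast at h
    exact h
  · have hr' : (X * r).natDegree ≤ n := by
      rcases eq_or_ne r 0 with rfl | hr0
      · simp
      · have := (natDegree_lt_iff_degree_lt hr0).2 hr
        rw [natDegree_X_mul hr0]
        omega
    rw [wpair_vw_succ, hg.wpair_eq _ hr', coeff_X_mul_zero]

/-- The differences `R_n` in terms of the reproducing kernels of the two weights with exponents
`0` and `1` at the origin. -/
theorem R_eq {g₀ g₁ : ℝ[X]} (hs : 0 < s) (hn : 0 < n) (hg₀ : IsReprAtZero 0 a s n g₀)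
    (hg₁ : IsReprAtZero 1 a s n g₁) (h₀ : 0 < g₀.coeff 0) (h₁ : 0 < g₁.coeff 0) {c : ℝ}
    (hc : c * (g₁.coeff 0 * wpair (vw 1 a s (4 * n)) g₀ g₀) = g₀.coeff 0 ^ 2) (hc1 : c ≠ 1) (z : ℂ) :
    R a n (-z / (4 * n)) (s / (4 * n)) =
      c / (1 - c) * (aeval (-z) g₀ / g₀.coeff 0 - aeval (-z) g₁ / g₁.coeff 0) := by
  obtain ⟨k, rfl⟩ : ∃ k, n = k + 1 := ⟨n - 1, by omega⟩
  set N : ℝ := 4 * (k + 1 : ℕ) with hNdef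
  have hN : 0 < N := by positivity
  have hw1 := isWeight_vw 1 a hs hN
  have hw2 := isWeight_vw 2 a hs hN
  set T := wpair (vw 1 a s N) g₀ g₀ with hT
  have hg₀ne : g₀ ≠ 0 := fun h => by simp [h] at h₀
  have hTpos : 0 < T := hw1.wpair_self_pos hg₀ne
  -- The second term is the projection of the first onto g₀ for exponent 1, because g₁ pairs with g₀
  -- to g₀(0). Thus P is a multiple of the kernel at 0 of degree n - 1, as in Christoffel–Darboux.
  set P : ℝ[X] := (g₁.coeff 0)⁻¹ • g₁ - (c * (g₀.coeff 0)⁻¹) • g₀ with hP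
  have hdegX : ∀ {r : ℝ[X]} {d : ℕ}, r.degree < d → (X * r).natDegree ≤ d := fun {r d} hr => by
    rcases eq_or_ne r 0 with rfl | hr0
    · simp
    · have := (natDegree_lt_iff_degree_lt hr0).2 hr
      rw [natDegree_X_mul hr0]
      omega
  have hlow : ∀ r : ℝ[X], r.degree < (k + 1 : ℕ) → wpair (vw 1 a s N) r g₀ = 0 := fun r hr => by
    rw [wpair_comm, wpair_vw_succ, hg₀.wpair_eq _ (hdegX hr), coeff_X_mul_zero]
  -- Since g₀ is orthogonal to lower degrees, pairing with it detects only the top coefficient, so P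
  -- orthogonal to g₀ loses a degree.
  have htop : ∀ f : ℝ[X], f.natDegree ≤ k + 1 →
      wpair (vw 1 a s N) f g₀ = f.coeff (k + 1) * wpair (vw 1 a s N) (X ^ (k + 1)) g₀ := by
    intro f hf
    have h1 := hlow _ (degree_sub_C_mul_lt (p := f) (monic_X_pow (k + 1)) (natDegree_X_pow _)
      (degree_le_natDegree.trans_lt (Nat.cast_lt.2 (Nat.lt_succ_of_le hf))))
    rw [← smul_eq_C_mul, ← hw1.form_apply, map_sub, map_smul, LinearMap.sub_apply,
      LinearMap.smul_apply, smul_eq_mul, sub_eq_zero] at h1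
    exact h1
  have hXne : wpair (vw 1 a s N) (X ^ (k + 1)) g₀ ≠ 0 := fun h => by
    have := htop g₀ hg₀.natDegree_le
    rw [h, mul_zero] at this
    exact hTpos.ne' this
  have hPdeg' : P.natDegree ≤ k + 1 := (natDegree_sub_le _ _).trans
    (max_le ((natDegree_smul_le _ _).trans hg₁.natDegree_le)
      ((natDegree_smul_le _ _).trans hg₀.natDegree_le))
  have hPpair : ∀ r, ∀ {ω : ℝ → ℝ}, IsWeight ω → wpair ω P r =
      (g₁.coeff 0)⁻¹ * wpair ω g₁ r - c * (g₀.coeff 0)⁻¹ * wpair ω g₀ r := fun r ω hω => by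
    rw [← hω.form_apply, hP]
    simp only [map_sub, map_smul, LinearMap.sub_apply, LinearMap.smul_apply, smul_eq_mul]
    rfl
  have hPtop : P.coeff (k + 1) = 0 := by
    have h1 := htop P hPdeg'
    have h2 : (g₁.coeff 0)⁻¹ * g₀.coeff 0 - c * (g₀.coeff 0)⁻¹ * T = 0 := by
      field_simp
      linarith
    rw [hPpair _ hw1, hg₁.wpair_eq _ hg₀.natDegree_le, ← hT, h2] at h1
    exact (mul_eq_zero.1 h1.symm).resolve_right hXne
  have hPdeg : P.natDegree ≤ k := by
    rw [natDegree_le_iff_coeff_eq_zero]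
    intro i hi
    rcases (Nat.succ_le_of_lt hi).eq_or_lt with rfl | hi'
    · exact hPtop
    · exact coeff_eq_zero_of_natDegree_lt (by omega)
  have hP0 : P.coeff 0 = 1 - c := by
    rw [hP, coeff_sub, coeff_smul, coeff_smul, smul_eq_mul, smul_eq_mul, mul_assoc,
      inv_mul_cancel₀ h₁.ne', inv_mul_cancel₀ h₀.ne', mul_one]
  have hc1' : (1 - c : ℝ) ≠ 0 := sub_ne_zero.2 hc1.symm
  -- For exponent 2, both g₁ and g₀ are orthogonal to degrees below k, since they are paired with X
  -- r and X (X r), which vanish at 0.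
  have hQ := Q_scaled_eq (n := k) a hs hN hPdeg (fun h => hc1' (by rw [← hP0, h, coeff_zero]))
    (fun r hr => by
      have hXX : (X * (X * r)).natDegree ≤ k + 1 := by
        refine natDegree_mul_le.trans ?_
        rw [natDegree_X]
        have := hdegX hr
        omega
      rw [hPpair _ hw2, wpair_vw_succ 1 a s N g₁ r,
        hg₁.wpair_eq _ ((hdegX hr).trans (Nat.le_succ k)), wpair_vw_succ 1 a s N g₀ r,
        wpair_vw_succ 0 a s N g₀ (X * r), hg₀.wpair_eq _ hXX, coeff_X_mul_zero, coeff_X_mul_zero]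
      ring) z
  have hQ1 := hg₁.Q_eq hs hn h₁ z
  rw [← coeff_zero_eq_aeval_zero', hP0] at hQ
  have hNc : (N : ℂ) = 4 * ((k + 1 : ℕ) : ℂ) := by rw [hNdef]; push_cast; ring
  rw [hNc] at hQ
  rw [R, hQ1, hQ, hP]
  have e1 : (g₁.coeff 0 : ℂ) ≠ 0 := Complex.ofReal_ne_zero.2 h₁.ne'
  have e0 : (g₀.coeff 0 : ℂ) ≠ 0 := Complex.ofReal_ne_zero.2 h₀.ne'
  have ec : (1 - c : ℂ) ≠ 0 := by exact_mod_cast hc1'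
  simp only [map_sub, map_smul, Complex.real_smul, Complex.coe_algebraMap]
  push_cast
  field_simp
  ring

/-- The entire function with real Taylor coefficients `c` at the origin. -/
def complexPowerSum (c : ℕ → ℝ) (z : ℂ) : ℂ := ∑' j, (c j : ℂ) * z ^ j

theorem IsMajorant.differentiable_complexPowerSum {b c : ℕ → ℝ} (hb : IsMajorant b)
    (hc : ∀ j, |c j| ≤ b j) : Differentiable ℂ (complexPowerSum c) := by
  intro z
  have h : DifferentiableOn ℂ (complexPowerSum c) (Metric.ball 0 (‖z‖ + 1)) := by
    refine Complex.differentiableOn_tsum_of_summable_norm (hb.summable (‖z‖ + 1) (by positivity))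
      (fun j => (by fun_prop)) Metric.isOpen_ball fun j w hw => ?_
    rw [norm_mul, norm_pow, Complex.norm_real, Real.norm_eq_abs]
    have : ‖w‖ ≤ ‖z‖ + 1 := (mem_ball_zero_iff.1 hw).le
    have := hb.nonneg j
    have := hc j
    gcongr
  exact h.differentiableAt (Metric.isOpen_ball.mem_nhds (by simp))

theorem IsMajorant.tendsto_aeval {b c : ℕ → ℝ} (hb : IsMajorant b) {g : ℕ → ℝ[X]}
    (hg : ∀ᶠ n in atTop, ∀ j, |(g n).coeff j| ≤ b j)
    (hc : ∀ j, Tendsto (fun n => (g n).coeff j) atTop (𝓝 (c j))) (z : ℂ) :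
    Tendsto (fun n => aeval z (g n)) atTop (𝓝 (complexPowerSum c z)) := by
  have h : ∀ f : ℝ[X], aeval z f = complexPowerSum f.coeff z := fun f => by
    rw [complexPowerSum, tsum_eq_sum (s := Finset.range (f.natDegree + 1)), aeval_eq_sum_range]
    · simp only [Complex.real_smul]
    · intro j hj
      rw [Finset.mem_range, not_lt] at hj
      rw [coeff_eq_zero_of_natDegree_lt (by omega), Complex.ofReal_zero, zero_mul]
  simp only [h]
  refine tendsto_tsum_of_dominated_convergence (hb.summable ‖z‖ (norm_nonneg z))
    (fun j => ((Complex.continuous_ofReal.tendsto _).comp (hc j)).mul_const _) ?_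
  filter_upwards [hg] with n hn j
  rw [norm_mul, norm_pow, Complex.norm_real, Real.norm_eq_abs]
  exact mul_le_mul_of_nonneg_right (hn j) (by positivity)

theorem exists_hard_edge_limit {a : ℝ} (ha : -1 < a) {s : ℝ} (hs : 0 < s) :
    ∃ q p : ℂ → ℂ, Differentiable ℂ q ∧ Differentiable ℂ p ∧ ∀ z : ℂ,
      Tendsto (fun n : ℕ => Q a n (-z / (4 * n)) (s / (4 * n))) atTop (𝓝 (q z)) ∧
      Tendsto (fun n : ℕ => (n : ℂ) * R a n (-z / (4 * n)) (s / (4 * n))) atTop (𝓝 (p z)) := by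
  obtain ⟨b₀, hb₀⟩ := exists_kernelBound (α := (0 : ℕ) + a) (by push_cast; linarith)
  obtain ⟨b₁, hb₁⟩ := exists_kernelBound (α := (1 : ℕ) + a) (by push_cast; linarith)
  -- At n = 0 nothing is required, and the zero polynomial fills the place.
  have hex : ∀ m n : ℕ, ∃ g, 0 < n → IsReprAtZero m a s n g := fun m n => by
    rcases n.eq_zero_or_pos with h | h
    · exact ⟨0, fun hn => absurd hn (by omega)⟩
    · obtain ⟨g, hg⟩ := exists_isReprAtZero m a hs h
      exact ⟨g, fun _ => hg⟩
  choose g hg using hex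
  obtain ⟨A₀, c₀, hA₀, hbd₀, hlim₀, hpos₀, l, hl⟩ := exists_tendsto_coeff hb₀ hs (hg 0)
  obtain ⟨A₁, c₁, hA₁, hbd₁, hlim₁, hpos₁, -⟩ := exists_tendsto_coeff hb₁ hs (hg 1)
  have hm₀ := hb₀.const_mul hA₀
  have hm₁ := hb₁.const_mul hA₁
  have hev₀ : ∀ᶠ n in atTop, ∀ j, |(g 0 n).coeff j| ≤ A₀ * b₀ j :=
    (eventually_gt_atTop 0).mono hbd₀
  have hev₁ : ∀ᶠ n in atTop, ∀ j, |(g 1 n).coeff j| ≤ A₁ * b₁ j :=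
    (eventually_gt_atTop 0).mono hbd₁
  have hcb₀ : ∀ j, |c₀ j| ≤ A₀ * b₀ j := fun j =>
    le_of_tendsto (hlim₀ j).abs (hev₀.mono fun n hn => hn j)
  have hcb₁ : ∀ j, |c₁ j| ≤ A₁ * b₁ j := fun j =>
    le_of_tendsto (hlim₁ j).abs (hev₁.mono fun n hn => hn j)
  have hc₀ : (c₀ 0 : ℂ) ≠ 0 := Complex.ofReal_ne_zero.2 hpos₀.ne'
  have hc₁ : (c₁ 0 : ℂ) ≠ 0 := Complex.ofReal_ne_zero.2 hpos₁.ne'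
  have hratio₀ : ∀ z : ℂ, Tendsto (fun n => aeval (-z) (g 0 n) / ((g 0 n).coeff 0 : ℂ)) atTop
      (𝓝 (complexPowerSum c₀ (-z) / c₀ 0)) := fun z =>
    (hm₀.tendsto_aeval hev₀ hlim₀ (-z)).div
      ((Complex.continuous_ofReal.tendsto _).comp (hlim₀ 0)) hc₀
  have hratio₁ : ∀ z : ℂ, Tendsto (fun n => aeval (-z) (g 1 n) / ((g 1 n).coeff 0 : ℂ)) atTop
      (𝓝 (complexPowerSum c₁ (-z) / c₁ 0)) := fun z =>
    (hm₁.tendsto_aeval hev₁ hlim₁ (-z)).div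
      ((Complex.continuous_ofReal.tendsto _).comp (hlim₁ 0)) hc₁
  set J : ℕ → ℝ := fun n => ∫ y in Ioi 0, s / (y + s) *
    (vw 0 a s (4 * n) y * ((g 0 n).eval y * (g 0 n).eval y)) with hJ
  set Δ : ℕ → ℝ := fun n => (1 + a) * (g 0 n).coeff 0 - a * J n with hΔ
  have hΔlim : Tendsto Δ atTop (𝓝 ((1 + a) * c₀ 0 - a * l)) :=
    ((hlim₀ 0).const_mul _).sub (hl.const_mul _)
  have hJ0 : ∀ n, 0 < n → 0 ≤ J n ∧ J n ≤ (g 0 n).coeff 0 := fun n hn => by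
    have hw := isWeight_vw 0 a (N := 4 * n) hs (by positivity)
    have hnn : ∀ y ∈ Ioi (0 : ℝ), 0 ≤ vw 0 a s (4 * n) y * ((g 0 n).eval y * (g 0 n).eval y) :=
      fun y hy => mul_nonneg (hw.pos y hy).le (mul_self_nonneg _)
    have hr : ∀ y ∈ Ioi (0 : ℝ), 0 ≤ s / (y + s) ∧ s / (y + s) ≤ 1 := fun y hy => by
      have hy0 : 0 < y := hy
      exact ⟨by positivity, (div_le_one (by positivity)).2 (by linarith)⟩
    refine ⟨setIntegral_nonneg measurableSet_Ioi fun y hy => mul_nonneg (hr y hy).1 (hnn y hy), ?_⟩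
    rw [← (hg 0 n hn).wpair_eq _ (hg 0 n hn).natDegree_le]
    refine integral_mono_of_nonneg ((ae_restrict_mem measurableSet_Ioi).mono fun y hy =>
      mul_nonneg (hr y hy).1 (hnn y hy)) (hw.int_mul _ _)
      ((ae_restrict_mem measurableSet_Ioi).mono fun y hy => ?_)
    exact mul_le_of_le_one_left (hnn y hy) (hr y hy).2
  -- The bounds 0 ≤ l ≤ c₀(0) suffice: the quantity is at least c₀(0) if a ≥ 0, and at least (1+a)
  -- c₀(0) if a < 0. The latter is where a > -1 enters.
  have hΔpos : 0 < (1 + a) * c₀ 0 - a * l := by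
    have h1 : 0 ≤ l := ge_of_tendsto hl ((eventually_gt_atTop 0).mono fun n hn => (hJ0 n hn).1)
    have h2 : l ≤ c₀ 0 := le_of_tendsto_of_tendsto hl (hlim₀ 0)
      ((eventually_gt_atTop 0).mono fun n hn => (hJ0 n hn).2)
    rcases le_or_gt 0 a with h | h
    · nlinarith
    · nlinarith [mul_pos (show 0 < 1 + a by linarith) hpos₀]
  -- This is n times the projection constant c of `R_eq`, after inserting T = 4n Δ_n; hence c =
  -- κ_n/n tends to 0 and n c/(1-c) converges.
  set κ : ℕ → ℝ := fun n => (g 0 n).coeff 0 ^ 2 / (4 * (g 1 n).coeff 0 * Δ n) with hκ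
  have hκlim : Tendsto κ atTop (𝓝 (c₀ 0 ^ 2 / (4 * c₁ 0 * ((1 + a) * c₀ 0 - a * l)))) :=
    ((hlim₀ 0).pow 2).div (((hlim₁ 0).const_mul 4).mul hΔlim) (by positivity)
  have hclim : Tendsto (fun n : ℕ => κ n / n) atTop (𝓝 0) :=
    hκlim.div_atTop tendsto_natCast_atTop_atTop
  have hfac : Tendsto (fun n : ℕ => κ n / (1 - κ n / n)) atTop
      (𝓝 (c₀ 0 ^ 2 / (4 * c₁ 0 * ((1 + a) * c₀ 0 - a * l)))) := by
    have := hκlim.div (hclim.const_sub 1) (by norm_num)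
    rwa [sub_zero, div_one] at this
  refine ⟨fun z => complexPowerSum c₁ (-z) / c₁ 0,
    fun z => ((c₀ 0 ^ 2 / (4 * c₁ 0 * ((1 + a) * c₀ 0 - a * l)) : ℝ) : ℂ) *
      (complexPowerSum c₀ (-z) / c₀ 0 - complexPowerSum c₁ (-z) / c₁ 0), ?_, ?_, fun z => ⟨?_, ?_⟩⟩
  · exact ((hm₁.differentiable_complexPowerSum hcb₁).comp differentiable_neg).div_const _
  · exact ((((hm₀.differentiable_complexPowerSum hcb₀).comp differentiable_neg).div_const _).sub
      (((hm₁.differentiable_complexPowerSum hcb₁).comp differentiable_neg).div_const _)).const_mul _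
  · refine (hratio₁ z).congr' ?_
    filter_upwards [eventually_gt_atTop 0, (hlim₁ 0).eventually (lt_mem_nhds hpos₁)] with n hn h1
    exact ((hg 1 n hn).Q_eq hs hn h1 z).symm
  · refine (((Complex.continuous_ofReal.tendsto _).comp hfac).mul
      ((hratio₀ z).sub (hratio₁ z))).congr' ?_
    filter_upwards [eventually_gt_atTop 0, (hlim₁ 0).eventually (lt_mem_nhds hpos₁),
      (hlim₀ 0).eventually (lt_mem_nhds hpos₀), hΔlim.eventually (lt_mem_nhds hΔpos),
      hclim.eventually (gt_mem_nhds one_pos)] with n hn h1 h0 hΔn hcn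
    have hn0 : (n : ℝ) ≠ 0 := Nat.cast_ne_zero.2 hn.ne'
    have hn0' : (n : ℂ) ≠ 0 := Nat.cast_ne_zero.2 hn.ne'
    have hT : wpair (vw 1 a s (4 * n)) (g 0 n) (g 0 n) = 4 * n * Δ n :=
      (hg 0 n hn).wpair_vw_one_self hs hn
    rw [R_eq hs hn (hg 0 n hn) (hg 1 n hn) h0 h1 (c := κ n / n) ?_ hcn.ne z]
    · simp only [Function.comp]
      push_cast
      field_simp
    · rw [hT, hκ]
      field_simp

end

end DeformedLaguerre

theorem mainTheorem6 (a : ℝ) (ha : -1 < a) :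
    ∃ q p : ℂ → ℝ → ℂ, ∀ s : ℝ, 0 < s →
      Differentiable ℂ (fun z => q z s) ∧
      Differentiable ℂ (fun z => p z s) ∧
      ∀ z : ℂ,
        Filter.Tendsto (fun n : ℕ => DeformedLaguerre.Q a n (-z / (4 * n)) (s / (4 * n)))
          Filter.atTop (nhds (q z s)) ∧
        Filter.Tendsto
          (fun n : ℕ => (n : ℂ) * DeformedLaguerre.R a n (-z / (4 * n)) (s / (4 * n)))
          Filter.atTop (nhds (p z s)) := by
  choose! q p h using fun (s : ℝ) (hs : 0 < s) => DeformedLaguerre.exists_hard_edge_limit ha hs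
  exact ⟨fun z s => q s z, fun z s => p s z, h⟩
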